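/- Let $k\ge 2$ be an integer, and call a positive integer $k$-free if it is not divisible by $p^k$ for any prime $p$. Then there exist a multiplicative function $f:\mathbb{N}\to\{-1,0,1\}$ (that is, $f(mn)=f(m)f(n)$ for all positive integers $m,n$ with $\gcd(m,n)=1$), supported on the $k$-free integers (that is, $f(n)=0$ whenever $n$ is not $k$-free), with $f(p)=\pm1$ at every prime $p$, and a constant $c>0$ such that $$\sum_{n\le x} f(n)\ll \frac{x^{1/k}}{\exp\left(c(\log x)^{1/4}\right)},$$ i.e. there is a constant $C>0$ such that $\left|\sum_{n\le x} f(n)\right|\le C\,x^{1/k}\exp\left(-c(\log x)^{1/4}\right)$ for all sufficiently large real $x$. -/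

import Mathlib

open Filter Asymptotics

/-- A natural number `n` is `k`-free if it is not divisible by `p ^ k` for any prime `p`. -/
def IsKFree (k n : ℕ) : Prop :=
  ∀ p : ℕ, p.Prime → ¬ p ^ k ∣ n

/-! Let g be the completely multiplicative function equal to the character χ₄ mod 4 on odd integers
and to 1 at 2 (`chiFourMod`), and let f be g restricted to the k-free integers. Since g(2n) = g(n),
halving repeatedly shows that the partial sums of g are O(log x). Möbius inversion over k-th power
divisors gives ∑_{n ≤ x} f(n) = ∑_d μ(d) g(d)^k G(x/d^k), where G is the summatory function of g.

The hyperbola method (`abs_sum_mul_sum_le`) is applied with l = (log x)^{1/4} and cut D about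
x^{1/k} e^{-l}. For d ≤ D the logarithmic bound on G costs x^{1/k} e^{-l} log x. For d > D the
cofactor m is at most about e^{kl}, and the sum over d saves exp(-c l²) by cancellation in ∑ μ(d)
g(d)^k, which outweighs e^{kl}.

That cancellation is the prime number theorem with classical error term for μχ, where χ = χ₄^k is
principal mod 4 when k is even and χ₄ when k is odd (`exists_norm_sum_mul_moebius_le`). Its proof is
local, without Hadamard products: a reflection argument on half discs bounds Re L'/L from below, and
3 + 4 cos θ + cos 2θ ≥ 0 then yields the zero-free region for |Im s| ≥ 1. Near the real axis,
nonvanishing on Re s = 1 and compactness suffice, the character being fixed. Borel–Carathéodory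
bounds 1/L by the square root of the height, a contour shift bounds Riesz means, and differencing
recovers the sharp sums. -/

/-! ### Local complex analysis: logarithmic derivatives and lower bounds on discs. -/

/-- Reflection principle on a half disc. -/
lemma norm_neg_le_norm_mul_exp_of_ne_zero {f : ℂ → ℂ} {R M m : ℝ} (hR : 0 < R) (hm : 0 < m)
    (hf : ∀ z, ‖z‖ ≤ R → DifferentiableAt ℂ f z)
    (h0 : ∀ z, ‖z‖ ≤ R → 0 ≤ z.re → f z ≠ 0)
    (hM : ∀ z, ‖z‖ = R → z.re ≤ 0 → ‖f z‖ ≤ M)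
    (hm' : ∀ z, ‖z‖ = R → 0 ≤ z.re → m ≤ ‖f z‖)
    {x : ℝ} (hx0 : 0 < x) (hxR : x < R) :
    ‖f (-x)‖ ≤ ‖f x‖ * Real.exp (2 * (Real.log (M / m) / R) * x) := by
  have hmM : m ≤ M := by
    have hn : ‖((R : ℂ) * Complex.I)‖ = R := by simp [abs_of_pos hR]
    exact (hm' _ hn (by simp)).trans (hM _ hn (by simp))
  have hMpos : 0 < M := hm.trans_le hmM
  set b := Real.log (M / m) with hb
  have hb0 : 0 ≤ b := Real.log_nonneg (by rw [le_div_iff₀ hm]; linarith)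
  set κ := b / R ^ 2 with hκ
  have hκ0 : 0 ≤ κ := by positivity
  set g : ℂ → ℂ := fun z => (starRingEnd ℂ) (f (-(starRingEnd ℂ) z)) with hg
  have hgd : ∀ z, ‖z‖ ≤ R → DifferentiableAt ℂ g z := by
    intro z hz
    have h1 : DifferentiableAt ℂ (fun w => f (-w)) ((starRingEnd ℂ) z) :=
      DifferentiableAt.comp _ (hf _ (by simpa using hz)) differentiableAt_id.neg
    simpa [hg, Function.comp_def] using! h1.conj_conj
  -- On the imaginary axis |g| = |f| and the exponential has modulus at most 1. On the arc |z| = R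
  -- with Re z ≥ 0, Re(2Rz - z²) ≥ R², so the exponential absorbs the ratio M/m = exp(κR²). The
  -- maximum principle then applies.
  set q : ℂ → ℂ := fun z => g z / f z * Complex.exp (-(κ : ℂ) * (2 * R * z - z ^ 2)) with hq
  set U : Set ℂ := {z | ‖z‖ < R ∧ 0 < z.re} with hU
  have hUo : IsOpen U :=
    (isOpen_lt continuous_norm continuous_const).inter
      (isOpen_lt continuous_const Complex.continuous_re)
  have hUb : Bornology.IsBounded U :=
    (Metric.isBounded_ball (x := (0 : ℂ)) (r := R)).subset fun z hz => by simpa using hz.1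
  have hUc : closure U ⊆ {z | ‖z‖ ≤ R ∧ 0 ≤ z.re} := by
    apply closure_minimal
    · exact fun z hz => ⟨hz.1.le, hz.2.le⟩
    · exact (isClosed_le continuous_norm continuous_const).inter
        (isClosed_le continuous_const Complex.continuous_re)
  have hqd : DifferentiableOn ℂ q (closure U) := by
    intro z hz
    obtain ⟨h1, h2⟩ := hUc hz
    apply DifferentiableAt.differentiableWithinAt
    exact ((hgd z h1).div (hf z h1) (h0 z h1 h2)).mul (by fun_prop)
  have hre : ∀ z : ℂ, (-(κ : ℂ) * (2 * R * z - z ^ 2)).re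
      = -(κ * (2 * R * z.re - (z.re ^ 2 - z.im ^ 2))) := by
    intro z
    simp [pow_two, Complex.mul_re, Complex.mul_im]
  have hnq : ∀ z, ‖q z‖ = ‖f (-(starRingEnd ℂ) z)‖ / ‖f z‖ *
      Real.exp (-(κ * (2 * R * z.re - (z.re ^ 2 - z.im ^ 2)))) := by
    intro z
    simp only [hq, hg, norm_mul, norm_div, Complex.norm_exp, hre, RCLike.norm_conj]
  have hfr : ∀ z ∈ frontier U, ‖q z‖ ≤ 1 := by
    intro z hz
    rw [hUo.frontier_eq] at hz
    obtain ⟨h1, h2⟩ := hUc hz.1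
    rw [hnq]
    have hfz : 0 < ‖f z‖ := norm_pos_iff.2 (h0 z h1 h2)
    rcases h1.eq_or_lt with h3 | h3
    · have h4 : ‖f (-(starRingEnd ℂ) z)‖ ≤ M := hM _ (by simpa using h3) (by simpa using h2)
      have h5 := hm' z h3 h2
      have hxy : z.re ^ 2 + z.im ^ 2 = R ^ 2 := by
        rw [← h3, Complex.sq_norm, Complex.normSq_apply]; ring
      have hzR : z.re ≤ R := by rw [← h3]; exact Complex.re_le_norm z
      have h6 : b ≤ κ * (2 * R * z.re - (z.re ^ 2 - z.im ^ 2)) := by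
        have : b = κ * R ^ 2 := by rw [hκ]; field_simp
        rw [this]
        gcongr
        nlinarith [mul_nonneg h2 (sub_nonneg.2 hzR)]
      calc _ ≤ M / m * Real.exp (-b) := by gcongr
        _ = 1 := by
          rw [Real.exp_neg, hb, Real.exp_log (by positivity), mul_inv_cancel₀ (by positivity)]
    · have h4 : z.re = 0 := by
        by_contra h
        exact hz.2 ⟨h3, lt_of_le_of_ne h2 (Ne.symm h)⟩
      have h5 : -(starRingEnd ℂ) z = z := by
        apply Complex.ext <;> simp [h4]
      rw [h5, div_self hfz.ne', one_mul, h4]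
      apply Real.exp_le_one_iff.2
      nlinarith [mul_nonneg hκ0 (sq_nonneg z.im)]
  have hxU : (x : ℂ) ∈ U := ⟨by simpa [abs_of_pos hx0] using hxR, by simpa using hx0⟩
  have key := Complex.norm_le_of_forall_mem_frontier_norm_le hUb hqd.diffContOnCl hfr
    (subset_closure hxU)
  rw [hnq] at key
  have hfx : 0 < ‖f x‖ := norm_pos_iff.2 (h0 x (by simpa [abs_of_pos hx0] using hxR.le)
    (by simpa using hx0.le))
  simp only [Complex.conj_ofReal, Complex.ofReal_re, Complex.ofReal_im] at key
  rw [Real.exp_neg, ← div_eq_mul_inv, div_div, div_le_one (by positivity)] at key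
  have hκx : 2 * (b / R) * x = κ * (2 * R * x) := by rw [hκ]; field_simp
  rw [hκx]
  refine key.trans (mul_le_mul_of_nonneg_left (Real.exp_le_exp.2 ?_) hfx.le)
  exact mul_le_mul_of_nonneg_left (by nlinarith [sq_nonneg x]) hκ0

/-- A lower bound for the real part of the logarithmic derivative at the centre of a disc, for a
function without zeros in the right half of the disc. -/
lemma neg_log_div_le_re_logDeriv {f : ℂ → ℂ} {R M m : ℝ} (hR : 0 < R) (hm : 0 < m)
    (hf : ∀ z, ‖z‖ ≤ R → DifferentiableAt ℂ f z)
    (h0 : ∀ z, ‖z‖ ≤ R → 0 ≤ z.re → f z ≠ 0)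
    (hM : ∀ z, ‖z‖ = R → z.re ≤ 0 → ‖f z‖ ≤ M)
    (hm' : ∀ z, ‖z‖ = R → 0 ≤ z.re → m ≤ ‖f z‖) :
    -(Real.log (M / m) / R) ≤ (deriv f 0 / f 0).re := by
  set a := Real.log (M / m) / R with ha
  have hd : HasDerivAt f (deriv f 0) ((0 : ℝ) : ℂ) := by
    simpa using! (hf 0 (by simpa using hR.le)).hasDerivAt
  have hd' : HasDerivAt (fun z => f (-z)) (-deriv f 0) ((0 : ℝ) : ℂ) := by
    have h1 : HasDerivAt f (deriv f 0) (-((0 : ℝ) : ℂ)) := by simpa using! hd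
    have := h1.scomp _ (hasDerivAt_neg ((0 : ℝ) : ℂ))
    simpa [Function.comp_def] using! this
  have h1 := hd.comp_ofReal.norm_sq
  have h2 := hd'.comp_ofReal.norm_sq
  have h3 : HasDerivAt (fun x : ℝ => Real.exp (4 * a * x)) (4 * a) 0 := by
    have := ((hasDerivAt_id (0 : ℝ)).const_mul (4 * a)).exp
    simpa using! this
  -- |f(x)|² exp(4ax) - |f(-x)|² vanishes at 0 and, by reflection, is nonnegative for small x > 0;
  -- its derivative at 0 is therefore nonnegative.
  have h4 := (h1.mul h3).sub h2
  have hpos : 0 ≤ 2 * inner ℝ (f ((0 : ℝ) : ℂ)) (deriv f 0) * Real.exp (4 * a * 0) +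
      ‖f ((0 : ℝ) : ℂ)‖ ^ 2 * (4 * a) - 2 * inner ℝ (f (-((0 : ℝ) : ℂ))) (-deriv f 0) := by
    have h5 := h4.hasDerivWithinAt (s := Set.Ioi 0)
    rw [hasDerivWithinAt_iff_tendsto_slope' (by simp)] at h5
    apply ge_of_tendsto h5
    have h6 : Set.Ioo (0 : ℝ) R ∈ nhdsWithin 0 (Set.Ioi 0) := Ioo_mem_nhdsGT hR
    filter_upwards [h6] with x hx
    have h7 := norm_neg_le_norm_mul_exp_of_ne_zero hR hm hf h0 hM hm' hx.1 hx.2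
    rw [slope_def_field]
    apply div_nonneg _ (by linarith [hx.1])
    have h8 : ‖f (-x)‖ ^ 2 ≤ ‖f x‖ ^ 2 * Real.exp (4 * a * x) := by
      have : Real.exp (4 * a * x) = Real.exp (2 * a * x) ^ 2 := by
        rw [← Real.exp_nat_mul]; congr 1; push_cast; ring
      rw [this, ← mul_pow]
      gcongr
    simp only [Pi.sub_apply, Pi.mul_apply]
    simp
    simpa using h8
  have hne : f 0 ≠ 0 := h0 0 (by simpa using hR.le) (by simp)
  have hn : 0 < ‖f 0‖ ^ 2 := by positivity
  simp only [Complex.ofReal_zero, neg_zero, mul_zero, Real.exp_zero, mul_one, inner_neg_right]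
    at hpos
  have h9 : (deriv f 0 / f 0).re = inner ℝ (f 0) (deriv f 0) / ‖f 0‖ ^ 2 := by
    rw [Complex.div_re, Complex.inner, Complex.sq_norm]
    simp only [Complex.mul_re, Complex.conj_re, Complex.conj_im]
    field_simp
    ring
  rw [h9, le_div_iff₀ hn]
  nlinarith

/-- The lower bound of `neg_log_div_le_re_logDeriv` improves in the presence of a zero to the left
of the centre. -/
lemma one_div_sub_log_div_le_re_logDeriv {f : ℂ → ℂ} {R M m z₀ : ℝ} (hR : 0 < R) (hm : 0 < m)
    (hf : ∀ᶠ z in nhdsSet (Metric.closedBall 0 R), DifferentiableAt ℂ f z)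
    (h0 : ∀ z, ‖z‖ ≤ R → 0 ≤ z.re → f z ≠ 0)
    (hM : ∀ z, ‖z‖ = R → z.re ≤ 0 → ‖f z‖ ≤ M)
    (hm' : ∀ z, ‖z‖ = R → 0 ≤ z.re → m ≤ ‖f z‖)
    (hz : 0 < z₀) (hzR : z₀ ≤ R / 2) (hfz : f (-z₀) = 0) :
    1 / z₀ - Real.log (3 * M / m) / R ≤ (deriv f 0 / f 0).re := by
  set g := dslope f (-z₀ : ℂ) with hg
  have hfg : ∀ z, f z = (z + z₀) * g z := by
    intro z
    have := sub_smul_dslope f (-z₀ : ℂ) z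
    rw [hfz, sub_zero, sub_neg_eq_add, smul_eq_mul] at this
    exact this.symm
  have hgd : ∀ z, ‖z‖ ≤ R → DifferentiableAt ℂ g z := by
    obtain ⟨V, hVo, hKV, hV⟩ := mem_nhdsSet_iff_exists.1 hf
    intro z hz'
    have hz₀ : V ∈ nhds (-z₀ : ℂ) :=
      hVo.mem_nhds (hKV (by simp [abs_of_pos hz]; linarith))
    have := (Complex.differentiableOn_dslope (f := f) hz₀).2
      fun w hw => (hV hw).differentiableWithinAt
    exact this.differentiableAt (hVo.mem_nhds (hKV (by simpa using hz')))
  have hnz : ∀ z : ℂ, ‖z‖ = R → R / 2 ≤ ‖z + z₀‖ ∧ ‖z + z₀‖ ≤ 3 * R / 2 := by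
    intro z hz'
    have h1 := norm_add_le z (z₀ : ℂ)
    have h2 := norm_sub_norm_le z (-z₀ : ℂ)
    simp only [sub_neg_eq_add, norm_neg, Complex.norm_real, Real.norm_eq_abs, abs_of_pos hz] at h1 h2
    constructor <;> linarith
  -- The factor z + z₀ lies between R/2 and 3R/2 on the circle, which costs the 3 inside the
  -- logarithm; its own logarithmic derivative at 0 supplies 1/z₀.
  have key := neg_log_div_le_re_logDeriv (f := g) (M := M / (R / 2)) (m := m / (3 * R / 2)) hR
    (by positivity) hgd
    (fun z h1 h2 h3 => h0 z h1 h2 (by rw [hfg, h3, mul_zero]))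
    (fun z h1 h2 => by
      have := hM z h1 h2
      rw [hfg, norm_mul] at this
      rw [le_div_iff₀ (by positivity)]
      nlinarith [(hnz z h1).1, norm_nonneg (g z)])
    (fun z h1 h2 => by
      have := hm' z h1 h2
      rw [hfg, norm_mul] at this
      rw [div_le_iff₀ (by positivity)]
      nlinarith [(hnz z h1).2, norm_nonneg (g z)])
  have he : M / (R / 2) / (m / (3 * R / 2)) = 3 * M / m := by field_simp
  rw [he] at key
  have hg0 : g 0 ≠ 0 := fun h => h0 0 (by simpa using hR.le) (by simp) (by rw [hfg, h, mul_zero])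
  have hz₀ : (z₀ : ℂ) ≠ 0 := by exact_mod_cast hz.ne'
  have hdf : deriv f 0 = g 0 + z₀ * deriv g 0 := by
    have h1 : f = fun z => (z + z₀) * g z := funext hfg
    have h2 : HasDerivAt (fun z : ℂ => (z + z₀) * g z) (1 * g 0 + (0 + z₀) * deriv g 0) 0 :=
      ((hasDerivAt_id (0 : ℂ)).add_const (z₀ : ℂ)).mul (hgd 0 (by simpa using hR.le)).hasDerivAt
    rw [h1, h2.deriv]; ring
  have hq : deriv f 0 / f 0 = ((1 / z₀ : ℝ) : ℂ) + deriv g 0 / g 0 := by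
    rw [hdf, hfg 0, zero_add]
    push_cast
    field_simp
  rw [hq, Complex.add_re, Complex.ofReal_re]
  linarith

/-- A lower bound near the centre for a function without zeros in a disc. -/
lemma norm_ge_of_ne_zero_on_ball {f : ℂ → ℂ} {c : ℂ} {ρ M m : ℝ} (hρ : 0 < ρ) (hm : 0 < m)
    (hmM : m < M)
    (hf : DifferentiableOn ℂ f (Metric.ball c ρ)) (h0 : ∀ z ∈ Metric.ball c ρ, f z ≠ 0)
    (hM : ∀ z ∈ Metric.ball c ρ, ‖f z‖ ≤ M) (hc : m ≤ ‖f c‖) {z : ℂ} (hz : ‖z - c‖ ≤ ρ / 9) :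
    m * Real.exp (-(Real.log (M / m) / 4)) ≤ ‖f z‖ := by
  have hcb : c ∈ Metric.ball c ρ := Metric.mem_ball_self hρ
  have hld : DifferentiableOn ℂ (fun z => deriv f z / f z) (Metric.ball c ρ) :=
    (hf.deriv Metric.isOpen_ball).div hf h0
  -- g is a branch of log(f / f(c)) vanishing at c.
  obtain ⟨g, hgc, hg⟩ := hld.isExactOn_ball.with_val_at c 0
  have hfa : ∀ w ∈ Metric.ball c ρ, HasDerivAt f (deriv f w) w := fun w hw =>
    (hf.differentiableAt (Metric.isOpen_ball.mem_nhds hw)).hasDerivAt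
  have hconst : ∀ w ∈ Metric.ball c ρ, f w * Complex.exp (-g w) = f c := by
    intro w hw
    have h1 : ∀ u ∈ Metric.ball c ρ,
        HasDerivAt (fun u => f u * Complex.exp (-g u)) 0 u := by
      intro u hu
      have := (hfa u hu).mul ((hg u hu).neg.cexp)
      refine this.congr_deriv ?_
      have := h0 u hu
      simp only [Pi.neg_apply]
      field_simp
      ring
    have h2 := (convex_ball c ρ).is_const_of_fderivWithin_eq_zero (𝕜 := ℂ)
      (fun u hu => (h1 u hu).differentiableAt.differentiableWithinAt)
      (fun u hu => by
        rw [fderivWithin_of_isOpen Metric.isOpen_ball hu]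
        have := (h1 u hu).hasFDerivAt.fderiv
        rw [this]; ext; simp) hw hcb
    simpa [hgc] using h2
  have hfw : ∀ w ∈ Metric.ball c ρ, ‖f w‖ = ‖f c‖ * Real.exp (g w).re := by
    intro w hw
    rw [← hconst w hw, norm_mul, Complex.norm_exp, Complex.neg_re, mul_assoc, ← Real.exp_add]
    simp
  set b := Real.log (M / m) with hb
  have hb0 : 0 < b := Real.log_pos (by rwa [lt_div_iff₀ hm, one_mul])
  have hgre : ∀ w ∈ Metric.ball c ρ, (g w).re ≤ b := by
    intro w hw
    have h1 := hM w hw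
    rw [hfw w hw] at h1
    rw [hb, Real.le_log_iff_exp_le (div_pos (hm.trans hmM) hm), le_div_iff₀ hm]
    nlinarith [Real.exp_pos (g w).re]
  have hzb : z - c ∈ Metric.ball (0 : ℂ) ρ := by
    rw [mem_ball_zero_iff]; linarith
  have hadd : ∀ w ∈ Metric.ball (0 : ℂ) ρ, c + w ∈ Metric.ball c ρ := by
    intro w hw; simpa using hw
  have hbc := Complex.borelCaratheodory_zero (f := fun w => g (c + w)) hb0
    (fun w hw => (DifferentiableAt.comp w (f := fun w => c + w) (g := g)
      (hg _ (hadd w hw)).differentiableAt (by fun_prop)).differentiableWithinAt)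
    (fun w hw => hgre _ (hadd w hw)) hρ hzb (by simpa using hgc)
  have hzb' : z ∈ Metric.ball c ρ := by simpa using hadd _ hzb
  simp only [add_sub_cancel] at hbc
  -- At distance at most ρ/9, Borel–Carathéodory has the factor 2·(1/9)/(8/9) = 1/4.
  have h1 : ‖g z‖ ≤ b / 4 := by
    refine hbc.trans ?_
    rw [div_le_iff₀ (by linarith)]
    nlinarith
  rw [hfw z hzb']
  have h2 : -(b / 4) ≤ (g z).re := by
    have := (abs_le.1 (Complex.abs_re_le_norm (g z))).1
    linarith
  gcongr

/-! ### Continuation and growth of Dirichlet L-functions in the right half plane. -/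

/-- Every window of length N sums to zero, so the partial sums are themselves periodic. -/
lemma exists_norm_sum_range_le_of_periodic {f : ℕ → ℂ} {N : ℕ} (hN : 0 < N)
    (hf : Function.Periodic f N) (h0 : ∑ i ∈ Finset.range N, f i = 0) :
    ∃ C : ℝ, ∀ m, ‖∑ i ∈ Finset.range m, f i‖ ≤ C := by
  have hsh : ∀ m, ∑ i ∈ Finset.range N, f (m + i) = 0 := by
    intro m
    induction m with
    | zero => simpa using h0
    | succ m ih =>
      have h1 := Finset.sum_range_succ (fun i => f (m + i)) N
      have h2 := Finset.sum_range_succ' (fun i => f (m + i)) N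
      rw [h1, ih, hf m] at h2
      simp only [zero_add, add_zero] at h2
      have h3 : ∀ i, f (m + (i + 1)) = f (m + 1 + i) := fun i => by congr 1; ring
      simp only [h3] at h2
      exact right_eq_add.1 h2
  have hP : Function.Periodic (fun m => ∑ i ∈ Finset.range m, f i) N := by
    intro m
    simp only [Finset.sum_range_add, hsh, add_zero]
  refine ⟨∑ j ∈ Finset.range N, ‖∑ i ∈ Finset.range j, f i‖, fun m => ?_⟩
  have h1 := hP.map_mod_nat m
  rw [← h1]
  exact Finset.single_le_sum (f := fun j => ‖∑ i ∈ Finset.range j, f i‖)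
    (fun _ _ => norm_nonneg _) (Finset.mem_range.2 (Nat.mod_lt _ hN))

namespace DirichletCharacter

variable {N : ℕ} [NeZero N] (χ : DirichletCharacter ℂ N)

/-- The partial sums of a Dirichlet character grow linearly, up to a bounded error. -/
lemma exists_norm_sum_Icc_sub_mul_le :
    ∃ (κ : ℂ) (C : ℝ), ∀ m : ℕ, ‖∑ k ∈ Finset.Icc 1 m, χ k - κ * m‖ ≤ C := by
  have hN : (N : ℂ) ≠ 0 := by exact_mod_cast NeZero.ne N
  set κ : ℂ := (∑ k ∈ Finset.range N, χ k) / N with hκ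
  obtain ⟨C, hC⟩ := exists_norm_sum_range_le_of_periodic (f := fun n => χ n - κ)
    (NeZero.pos N) (fun n => by simp)
    (by rw [Finset.sum_sub_distrib, Finset.sum_const, Finset.card_range, nsmul_eq_mul, hκ,
          mul_div_cancel₀ _ hN, sub_self])
  refine ⟨κ, C + ‖χ 0 - κ‖, fun m => ?_⟩
  have h1 : ∑ k ∈ Finset.Icc 1 m, χ k - κ * m =
      ∑ k ∈ Finset.range (m + 1), (χ k - κ) - (χ 0 - κ) := by
    rw [Finset.sum_range_succ', Finset.sum_sub_distrib, Finset.sum_const, Finset.card_range,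
      nsmul_eq_mul, Finset.range_eq_Ico, Finset.sum_Ico_add' (fun k : ℕ => χ (k : ZMod N))]
    have : Finset.Ico (0 + 1) (m + 1) = Finset.Icc 1 m := by rfl
    rw [this]
    simp
    ring
  rw [h1]
  exact (norm_sub_le _ _).trans (add_le_add_left (hC _) _)

end DirichletCharacter

section MellinTail

open MeasureTheory

variable {B : ℝ → ℂ} {C : ℝ}

lemma differentiableAt_mellin_indicator_neg (hB : Measurable B) (hC : ∀ t, 1 < t → ‖B t‖ ≤ C)
    {s : ℂ} (hs : 0 < s.re) :
    DifferentiableAt ℂ (fun s => mellin (Set.indicator (Set.Ioi 1) B) (-s)) s := by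
  have hC0 : 0 ≤ C := (norm_nonneg _).trans (hC 2 (by norm_num))
  have hbd : ∀ t, ‖Set.indicator (Set.Ioi 1) B t‖ ≤ C := by
    intro t
    by_cases ht : t ∈ Set.Ioi (1 : ℝ)
    · rw [Set.indicator_of_mem ht]; exact hC t ht
    · rw [Set.indicator_of_notMem ht]; simpa using hC0
  have hmeas : Measurable (Set.indicator (Set.Ioi 1) B) := hB.indicator measurableSet_Ioi
  have hd : DifferentiableAt ℂ (mellin (Set.indicator (Set.Ioi 1) B)) (-s) := by
    apply mellin_differentiableAt_of_isBigO_rpow (a := 0) (b := (-s).re - 1)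
    · exact ((memLp_top_of_bound hmeas.aestronglyMeasurable C
        (Eventually.of_forall hbd)).locallyIntegrable le_top).locallyIntegrableOn _
    · simp only [neg_zero, Real.rpow_zero]
      exact IsBigO.of_bound C (Eventually.of_forall fun t => by simpa using hbd t)
    · simpa using hs
    · apply IsBigO.of_bound 1
      filter_upwards [mem_nhdsWithin_of_mem_nhds (Iio_mem_nhds (zero_lt_one' ℝ))] with t ht
      rw [Set.indicator_of_notMem (by simpa using le_of_lt ht), norm_zero]
      positivity
    · linarith
  exact hd.comp s differentiableAt_id.neg

lemma mellin_indicator_neg (s : ℂ) :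
    mellin (Set.indicator (Set.Ioi 1) B) (-s) = ∫ t in Set.Ioi (1 : ℝ), B t * (t : ℂ) ^ (-(s + 1)) := by
  rw [mellin, ← integral_indicator measurableSet_Ioi, ← integral_indicator measurableSet_Ioi]
  congr 1
  ext t
  by_cases ht : 1 < t
  · rw [Set.indicator_of_mem (by simpa using zero_lt_one.trans ht), Set.indicator_of_mem (Set.mem_Ioi.2 ht),
      Set.indicator_of_mem (Set.mem_Ioi.2 ht), smul_eq_mul, mul_comm]
    congr 2
    ring
  · rw [Set.indicator_of_notMem (s := Set.Ioi 1) (by simpa using ht)]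
    by_cases h0 : 0 < t
    · rw [Set.indicator_of_mem (by simpa using h0),
        Set.indicator_of_notMem (s := Set.Ioi 1) (by simpa using ht), smul_zero]
    · rw [Set.indicator_of_notMem (by simpa using h0)]

lemma norm_mul_cpow_neg_le (hC : ∀ t, 1 < t → ‖B t‖ ≤ C) (s : ℂ) {t : ℝ} (ht : 1 < t) :
    ‖B t * (t : ℂ) ^ (-(s + 1))‖ ≤ C * t ^ (-(s.re + 1)) := by
  rw [norm_mul, Complex.norm_cpow_eq_rpow_re_of_pos (zero_lt_one.trans ht)]
  simp only [Complex.neg_re, Complex.add_re, Complex.one_re]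
  gcongr
  exact hC t ht

lemma norm_mellin_indicator_neg_le (hC : ∀ t, 1 < t → ‖B t‖ ≤ C) {s : ℂ} (hs : 0 < s.re) :
    ‖mellin (Set.indicator (Set.Ioi 1) B) (-s)‖ ≤ C / s.re := by
  rw [mellin_indicator_neg]
  have h1 : IntegrableOn (fun t : ℝ => C * t ^ (-(s.re + 1))) (Set.Ioi 1) :=
    (integrableOn_Ioi_rpow_of_lt (by linarith) zero_lt_one).const_mul C
  have h2 : ∫ t in Set.Ioi (1 : ℝ), C * t ^ (-(s.re + 1)) = C / s.re := by
    rw [integral_const_mul, integral_Ioi_rpow_of_lt (by linarith) zero_lt_one]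
    simp only [Real.one_rpow]
    rw [show -(s.re + 1) + 1 = -s.re by ring]
    field_simp
  rw [← h2]
  refine norm_integral_le_of_norm_le h1 ?_
  filter_upwards [ae_restrict_mem measurableSet_Ioi] with t ht
  exact norm_mul_cpow_neg_le hC s ht

lemma integrableOn_mul_cpow_neg (hB : Measurable B) (hC : ∀ t, 1 < t → ‖B t‖ ≤ C) {s : ℂ}
    (hs : 0 < s.re) : IntegrableOn (fun t : ℝ => B t * (t : ℂ) ^ (-(s + 1))) (Set.Ioi 1) := by
  have h1 : IntegrableOn (fun t : ℝ => C * t ^ (-(s.re + 1))) (Set.Ioi 1) :=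
    (integrableOn_Ioi_rpow_of_lt (by linarith) zero_lt_one).const_mul C
  refine Integrable.mono' h1 ?_ ?_
  · apply Measurable.aestronglyMeasurable
    fun_prop
  · filter_upwards [ae_restrict_mem measurableSet_Ioi] with t ht
    exact norm_mul_cpow_neg_le hC s ht

end MellinTail

namespace DirichletCharacter

open MeasureTheory

variable {N : ℕ} [NeZero N] (χ : DirichletCharacter ℂ N)

/-- There is an entire function extending `(s - 1) * L(χ, s)`. -/
lemma exists_differentiable_eq_sub_one_mul_LFunction :
    ∃ F : ℂ → ℂ, Differentiable ℂ F ∧ ∀ s, s ≠ 1 → F s = (s - 1) * LFunction χ s := by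
  by_cases hχ : χ = 1
  · subst hχ
    exact ⟨LFunctionTrivChar₁ N, differentiable_LFunctionTrivChar₁ N,
      fun s hs => Function.update_of_ne hs ..⟩
  · exact ⟨fun s => (s - 1) * LFunction χ s,
      (differentiable_id.sub_const 1).mul (differentiable_LFunction hχ), fun _ _ => rfl⟩

/-- The analytic continuation of a Dirichlet L-function to the right half plane, with a bound. -/
lemma exists_LFunction_eq_div_add :
    ∃ (κ : ℂ) (C : ℝ) (E : ℂ → ℂ), (∀ s : ℂ, 0 < s.re → ‖E s‖ ≤ C / s.re) ∧
      ∀ s : ℂ, 0 < s.re → s ≠ 1 → LFunction χ s = κ * s / (s - 1) + s * E s := by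
  obtain ⟨κ, C₀, hC₀⟩ := χ.exists_norm_sum_Icc_sub_mul_le
  set A : ℝ → ℂ := fun t => ∑ k ∈ Finset.Icc 1 ⌊t⌋₊, χ k with hA
  set B : ℝ → ℂ := fun t => A t - κ * t with hB
  have hAm : Measurable A :=
    (measurable_from_nat (f := fun n : ℕ => ∑ k ∈ Finset.Icc 1 n, χ k)).comp Nat.measurable_floor
  have hBm : Measurable B := hAm.sub (by fun_prop)
  have hBC : ∀ t, 1 < t → ‖B t‖ ≤ C₀ + ‖κ‖ := by
    intro t ht
    have h1 : B t = (A t - κ * ⌊t⌋₊) + κ * (⌊t⌋₊ - t) := by simp only [hB]; ring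
    rw [h1]
    refine (norm_add_le _ _).trans (add_le_add (hC₀ _) ?_)
    rw [norm_mul]
    refine mul_le_of_le_one_right (norm_nonneg _) ?_
    have h2 := Nat.floor_le (zero_le_one.trans ht.le)
    have h3 := Nat.lt_floor_add_one t
    have h4 : ‖((⌊t⌋₊ : ℂ) - t)‖ = |(⌊t⌋₊ : ℝ) - t| := by
      rw [← Real.norm_eq_abs, ← Complex.norm_real]; push_cast; rfl
    rw [h4, abs_le]
    constructor <;> linarith
  set E : ℂ → ℂ := fun s => mellin (Set.indicator (Set.Ioi 1) B) (-s) with hE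
  refine ⟨κ, C₀ + ‖κ‖, E, fun s hs => norm_mellin_indicator_neg_le hBC hs, ?_⟩
  -- Abel summation, with the summatory function of χ split as κt + B(t): the linear part integrates
  -- to the polar term.
  have hser : ∀ s : ℂ, 1 < s.re → LFunction χ s = κ * s / (s - 1) + s * E s := by
    intro s hs
    have hs1 : s - 1 ≠ 0 := by
      intro h; rw [sub_eq_zero] at h; rw [h] at hs; simp at hs
    rw [LFunction_eq_LSeries χ hs, LSeries_eq_mul_integral' (fun n : ℕ => χ n) zero_le_one hs]
    · have h1 : ∀ t ∈ Set.Ioi (1 : ℝ), (∑ k ∈ Finset.Icc 1 ⌊t⌋₊, χ k) * (t : ℂ) ^ (-(s + 1)) =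
          κ * (t : ℂ) ^ (-s) + B t * (t : ℂ) ^ (-(s + 1)) := by
        intro t ht
        have ht0 : (t : ℂ) ≠ 0 := by
          exact_mod_cast (zero_lt_one.trans (show (1 : ℝ) < t from ht)).ne'
        have h2 : (t : ℂ) ^ (-s) = t * (t : ℂ) ^ (-(s + 1)) := by
          rw [show -s = 1 + (-(s + 1)) by ring, Complex.cpow_add _ _ ht0, Complex.cpow_one]
        rw [h2]
        simp only [hB, hA]
        ring
      have hsn : (-s).re < -1 := by simpa using hs
      rw [setIntegral_congr_fun measurableSet_Ioi h1, integral_add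
        ((integrableOn_Ioi_cpow_of_lt hsn zero_lt_one).const_mul κ)
        (integrableOn_mul_cpow_neg hBm hBC (by linarith)), integral_const_mul,
        integral_Ioi_cpow_of_lt hsn zero_lt_one, ← mellin_indicator_neg]
      have h3 : -s + 1 ≠ 0 := by intro h; apply hs1; linear_combination -h
      simp only [Complex.ofReal_one, Complex.one_cpow]
      rw [show -s + 1 = -(s - 1) by ring]
      simp only [hE]
      field_simp
    · refine IsBigO.of_bound 1 (Eventually.of_forall fun n => ?_)
      rw [Real.norm_of_nonneg (Finset.sum_nonneg fun _ _ => norm_nonneg _), Real.rpow_one, one_mul,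
        Real.norm_of_nonneg (Nat.cast_nonneg n)]
      calc ∑ k ∈ Finset.Icc 1 n, ‖χ k‖ ≤ ∑ k ∈ Finset.Icc 1 n, (1 : ℝ) :=
            Finset.sum_le_sum fun k _ => χ.norm_le_one _
        _ = n := by simp
  obtain ⟨F, hFd, hF⟩ := χ.exists_differentiable_eq_sub_one_mul_LFunction
  set V : Set ℂ := {s | 0 < s.re} with hV
  have hVo : IsOpen V := isOpen_lt continuous_const Complex.continuous_re
  have hVc : IsPreconnected V := (convex_halfSpace_re_gt 0).isPreconnected
  have hG : AnalyticOnNhd ℂ (fun s => κ * s + (s - 1) * (s * E s)) V := by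
    refine DifferentiableOn.analyticOnNhd (fun s hs => ?_) hVo
    have hEd : DifferentiableAt ℂ E s := differentiableAt_mellin_indicator_neg hBm hBC hs
    apply DifferentiableAt.differentiableWithinAt
    fun_prop
  have hF' : AnalyticOnNhd ℂ F V := fun s _ => hFd.analyticAt s
  -- Multiplying by s - 1 removes the pole, so the identity theorem carries the formula from Re s >
  -- 1 to the whole half plane.
  have heq : Set.EqOn F (fun s => κ * s + (s - 1) * (s * E s)) V := by
    refine hF'.eqOn_of_preconnected_of_eventuallyEq hG hVc (z₀ := 2) (by simp [hV]) ?_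
    have h2 : {s : ℂ | 1 < s.re} ∈ nhds (2 : ℂ) :=
      (isOpen_lt continuous_const Complex.continuous_re).mem_nhds (by simp)
    filter_upwards [h2] with s hs
    have hs1 : s ≠ 1 := by rintro rfl; simp at hs
    rw [hF s hs1, hser s hs]
    have := sub_ne_zero.2 hs1
    field_simp
  intro s hs hs1
  have h1 := heq hs
  rw [hF s hs1] at h1
  have h2 := sub_ne_zero.2 hs1
  simp only at h1
  have h3 : LFunction χ s = (κ * s + (s - 1) * (s * E s)) / (s - 1) := by
    rw [eq_div_iff h2, ← h1]; ring
  rw [h3, add_div, mul_div_cancel_left₀ _ h2]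

/-- Polynomial growth of Dirichlet L-functions in vertical strips. -/
lemma exists_norm_LFunction_le :
    ∃ C : ℝ, 0 < C ∧ ∀ s : ℂ, 1 / 2 ≤ s.re → s.re ≤ 2 → 1 / 2 ≤ |s.im| →
      ‖LFunction χ s‖ ≤ C * (|s.im| + 4) := by
  obtain ⟨κ, C, E, hE, hL⟩ := χ.exists_LFunction_eq_div_add
  have hC : 0 ≤ C := by
    have := (norm_nonneg _).trans (hE 1 (by simp)); simpa using this
  refine ⟨2 * ‖κ‖ + 2 * C + 1, by positivity, fun s h1 h2 h3 => ?_⟩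
  have hs1 : s ≠ 1 := by
    rintro rfl; norm_num at h3
  rw [hL s (by linarith) hs1]
  have hn : ‖s‖ ≤ |s.im| + 4 := by
    have := Complex.norm_le_abs_re_add_abs_im s
    rw [abs_of_nonneg (by linarith : 0 ≤ s.re)] at this
    linarith
  have hn1 : 1 / 2 ≤ ‖s - 1‖ := by
    have := Complex.abs_im_le_norm (s - 1)
    simp at this
    linarith
  have hE' : ‖E s‖ ≤ 2 * C := by
    refine (hE s (by linarith)).trans ?_
    rw [div_le_iff₀ (by linarith)]
    nlinarith
  have hpos : 0 ≤ |s.im| + 4 := by positivity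
  calc _ ≤ ‖κ * s / (s - 1)‖ + ‖s * E s‖ := norm_add_le _ _
    _ = ‖κ‖ * ‖s‖ / ‖s - 1‖ + ‖s‖ * ‖E s‖ := by simp
    _ ≤ ‖κ‖ * (|s.im| + 4) / (1 / 2) + (|s.im| + 4) * (2 * C) := by gcongr
    _ ≤ _ := by nlinarith

end DirichletCharacter

/-! ### Bounds to the right of Re s = 1 and the zero-free region. -/

/-- Comparison with ζ(σ) ≤ σ/(σ - 1). -/
lemma norm_LSeries_le {a : ℕ → ℂ} (ha : ∀ n, ‖a n‖ ≤ 1) {s : ℂ} (hs : 1 < s.re) :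
    ‖LSeries a s‖ ≤ s.re / (s.re - 1) := by
  have h0 : 0 < s.re - 1 := by linarith
  have hsum : Summable (fun n : ℕ => 1 / ((n : ℝ) + 1) ^ s.re) := by
    have := (summable_nat_add_iff 1).2 (Real.summable_one_div_nat_rpow.2 hs)
    simpa using this
  have hb : ∀ n : ℕ, ‖LSeries.term a s (n + 1)‖ ≤ 1 / ((n : ℝ) + 1) ^ s.re := by
    intro n
    rw [LSeries.norm_term_eq, if_neg (by lia)]
    push_cast
    gcongr
    exact ha _
  have hle : ∑' n : ℕ, 1 / ((n : ℝ) + 1) ^ s.re ≤ s.re / (s.re - 1) := by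
    have h1 := ZetaAsymptotics.zeta_limit_aux1 hs
    have h2 : 0 ≤ ZetaAsymptotics.termTSum s.re :=
      tsum_nonneg fun n => ZetaAsymptotics.term_nonneg _ _
    have h3 : s.re / (s.re - 1) = 1 + 1 / (s.re - 1) := by field_simp; ring
    rw [h3]
    nlinarith
  have hst : Summable (LSeries.term a s) := by
    rw [← summable_nat_add_iff 1]
    exact Summable.of_norm_bounded hsum hb
  rw [LSeries, hst.tsum_eq_zero_add, LSeries.term_zero, zero_add]
  exact (tsum_of_norm_bounded hsum.hasSum hb).trans hle

lemma sub_one_div_le_sub_one_div {a b : ℝ} (ha : 1 < a) (hab : a ≤ b) :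
    (a - 1) / a ≤ (b - 1) / b := by
  rw [div_le_div_iff₀ (by linarith) (by linarith)]; nlinarith

lemma one_le_log_add_four {t : ℝ} (ht : 0 ≤ t) : 1 ≤ Real.log (t + 4) := by
  rw [Real.le_log_iff_exp_le (by linarith)]
  linarith [Real.exp_one_lt_d9]

namespace DirichletCharacter

lemma norm_mul_moebius_le_one {N : ℕ} (χ : DirichletCharacter ℂ N) (n : ℕ) :
    ‖χ n * (ArithmeticFunction.moebius n : ℂ)‖ ≤ 1 := by
  rw [norm_mul]
  refine mul_le_one₀ (χ.norm_le_one _) (norm_nonneg _) ?_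
  rw [Complex.norm_intCast]
  exact_mod_cast ArithmeticFunction.abs_moebius_le_one

variable {N : ℕ} [NeZero N] (χ : DirichletCharacter ℂ N)

lemma LSeries_mul_moebius_eq_inv {s : ℂ} (hs : 1 < s.re) :
    LSeries (fun n => χ n * (ArithmeticFunction.moebius n : ℂ)) s = (LFunction χ s)⁻¹ := by
  rw [LFunction_eq_LSeries χ hs]
  exact eq_inv_of_mul_eq_one_right (LSeries.mul_mu_eq_one χ hs)

/-- 1/L is the Dirichlet series of χμ, whose coefficients are bounded by 1. -/
lemma sub_one_div_le_norm_LFunction {s : ℂ} (hs : 1 < s.re) :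
    (s.re - 1) / s.re ≤ ‖LFunction χ s‖ := by
  have h1 := norm_LSeries_le χ.norm_mul_moebius_le_one hs
  have h0 : 0 < s.re - 1 := by linarith
  rw [χ.LSeries_mul_moebius_eq_inv hs, norm_inv] at h1
  have hne : 0 < ‖LFunction χ s‖ :=
    norm_pos_iff.2 (LFunction_ne_zero_of_one_le_re χ
      (Or.inr (by rintro rfl; simp at hs)) hs.le)
  rw [inv_le_comm₀ hne (by positivity), inv_div] at h1
  exact h1

lemma neg_deriv_div_LFunction_eq {s : ℂ} (hs : 1 < s.re) :
    -(deriv (LFunction χ) s / LFunction χ s) =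
      LSeries (fun n => χ n * (ArithmeticFunction.vonMangoldt n : ℂ)) s := by
  rw [LFunction_eq_LSeries χ hs, deriv_LFunction_eq_deriv_LSeries χ hs, ← neg_div]
  exact (LSeries_twist_vonMangoldt_eq χ hs).symm

/-- The inequality `3 + 4 cos θ + cos 2θ ≥ 0` for logarithmic derivatives of L-functions. -/
lemma re_deriv_div_LFunction_comb_le {x : ℝ} (hx : 1 < x) (t : ℝ) :
    (3 * (deriv (LFunction (1 : DirichletCharacter ℂ N)) x /
          LFunction (1 : DirichletCharacter ℂ N) x) +
      4 * (deriv (LFunction χ) (x + t * Complex.I) / LFunction χ (x + t * Complex.I)) +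
      deriv (LFunction (χ ^ 2)) (x + (2 * t : ℝ) * Complex.I) /
        LFunction (χ ^ 2) (x + (2 * t : ℝ) * Complex.I)).re ≤ 0 := by
  have h1 : 1 < (x : ℂ).re := by simpa
  have h2 : 1 < ((x : ℂ) + t * Complex.I).re := by simpa
  have h3 : 1 < ((x : ℂ) + (2 * t : ℝ) * Complex.I).re := by simpa
  have e1 := neg_deriv_div_LFunction_eq (1 : DirichletCharacter ℂ N) h1
  have e2 := neg_deriv_div_LFunction_eq χ h2
  have e3 := neg_deriv_div_LFunction_eq (χ ^ 2) h3
  have s1 : Summable (LSeries.term (fun n => (1 : DirichletCharacter ℂ N) n *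
    (ArithmeticFunction.vonMangoldt n : ℂ)) x) := LSeriesSummable_twist_vonMangoldt _ h1
  have s2 : Summable (LSeries.term (fun n => χ n *
    (ArithmeticFunction.vonMangoldt n : ℂ)) (x + t * Complex.I)) :=
      LSeriesSummable_twist_vonMangoldt χ h2
  have s3 : Summable (LSeries.term (fun n => (χ ^ 2) n *
    (ArithmeticFunction.vonMangoldt n : ℂ)) (x + (2 * t : ℝ) * Complex.I)) :=
      LSeriesSummable_twist_vonMangoldt _ h3
  have key : 0 ≤ (3 * LSeries (fun n => (1 : DirichletCharacter ℂ N) n *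
      (ArithmeticFunction.vonMangoldt n : ℂ)) x +
      4 * LSeries (fun n => χ n * (ArithmeticFunction.vonMangoldt n : ℂ)) (x + t * Complex.I) +
      LSeries (fun n => (χ ^ 2) n * (ArithmeticFunction.vonMangoldt n : ℂ))
        (x + (2 * t : ℝ) * Complex.I)).re := by
    simp only [LSeries]
    rw [← tsum_mul_left, ← tsum_mul_left, ← (s1.mul_left 3).tsum_add (s2.mul_left 4),
      ← ((s1.mul_left 3).add (s2.mul_left 4)).tsum_add s3,
      Complex.re_tsum (((s1.mul_left 3).add (s2.mul_left 4)).add s3)]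
    refine tsum_nonneg fun n => ?_
    rcases eq_or_ne n 0 with rfl | hn
    · simp
    · rw [LSeries.term_of_ne_zero hn, LSeries.term_of_ne_zero hn, LSeries.term_of_ne_zero hn]
      have hn0 : (n : ℂ) ≠ 0 := by exact_mod_cast hn
      have hnr : (0 : ℝ) < n := by exact_mod_cast Nat.pos_of_ne_zero hn
      set w : ℂ := (n : ℂ) ^ ((t : ℂ) * Complex.I) with hw
      have hw1 : ‖w‖ = 1 := by
        rw [hw, Complex.norm_natCast_cpow_of_pos (Nat.pos_of_ne_zero hn)]
        simp
      have hw0 : w ≠ 0 := fun h => by rw [h] at hw1; simp at hw1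
      have p1 : (n : ℂ) ^ ((x : ℂ) + t * Complex.I) = (n : ℂ) ^ (x : ℂ) * w :=
        Complex.cpow_add _ _ hn0
      have p2 : (n : ℂ) ^ ((x : ℂ) + (2 * t : ℝ) * Complex.I) = (n : ℂ) ^ (x : ℂ) * w ^ 2 := by
        rw [Complex.cpow_add _ _ hn0, hw, ← Complex.cpow_nat_mul]
        congr 2
        push_cast; ring
      have p3 : (n : ℂ) ^ (x : ℂ) = ((n : ℝ) ^ x : ℝ) := by
        rw [Complex.ofReal_cpow hnr.le]; simp
      have hp : 0 < (n : ℝ) ^ x := Real.rpow_pos_of_pos hnr x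
      have hΛ : 0 ≤ ArithmeticFunction.vonMangoldt n := ArithmeticFunction.vonMangoldt_nonneg
      have hfac : 3 * ((1 : DirichletCharacter ℂ N) n * (ArithmeticFunction.vonMangoldt n : ℂ) /
          (n : ℂ) ^ (x : ℂ)) + 4 * (χ n * (ArithmeticFunction.vonMangoldt n : ℂ) /
          (n : ℂ) ^ ((x : ℂ) + t * Complex.I)) +
          (χ ^ 2) n * (ArithmeticFunction.vonMangoldt n : ℂ) /
            (n : ℂ) ^ ((x : ℂ) + (2 * t : ℝ) * Complex.I) =
          ((ArithmeticFunction.vonMangoldt n / (n : ℝ) ^ x : ℝ) : ℂ) *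
            (3 * (1 : DirichletCharacter ℂ N) n + 4 * (χ n / w) + (χ n / w) ^ 2) := by
        rw [p1, p2, p3, χ.pow_apply' two_ne_zero]
        have : (((n : ℝ) ^ x : ℝ) : ℂ) ≠ 0 := by exact_mod_cast hp.ne'
        push_cast
        field_simp
      rw [hfac, Complex.re_ofReal_mul]
      refine mul_nonneg (div_nonneg hΛ hp.le) ?_
      -- For |v| = 1, 3 + 4 Re v + Re v² = 2(Re v + 1)²; at non-units all three characters vanish.
      by_cases hu : IsUnit (n : ZMod N)
      · rw [MulChar.one_apply hu]
        set v := χ n / w with hv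
        have hv1 : ‖v‖ = 1 := by
          rw [hv, norm_div, hw1, div_one]
          obtain ⟨u, hu⟩ := hu
          rw [← hu]
          exact χ.unit_norm_eq_one u
        have : v.re ^ 2 + v.im ^ 2 = 1 := by
          have h := Complex.sq_norm v
          rw [hv1, Complex.normSq_apply] at h
          nlinarith
        have e : (3 * (1 : ℂ) + 4 * v + v ^ 2).re = 3 + 4 * v.re + (v.re ^ 2 - v.im ^ 2) := by
          simp [pow_two]
        rw [e]
        nlinarith [sq_nonneg (v.re + 1)]
      · rw [MulChar.map_nonunit _ hu, MulChar.map_nonunit _ hu]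
        simp
  rw [← e1, ← e2, ← e3] at key
  have : ∀ a b c : ℂ, (3 * -a + 4 * -b + -c).re = -((3 * a + 4 * b + c).re) := by
    intro a b c; rw [← Complex.neg_re]; congr 1; ring
  rw [this] at key
  linarith

/-- The pole at 1 is simple, so subtracting 1/(s - 1) from -L'/L leaves a function continuous on the
segment [1, 2]. -/
lemma exists_neg_re_deriv_div_LFunction_one_le :
    ∃ C : ℝ, 0 < C ∧ ∀ x : ℝ, 1 < x → x ≤ 2 →
      -(deriv (LFunction (1 : DirichletCharacter ℂ N)) x /
          LFunction (1 : DirichletCharacter ℂ N) x).re ≤ 1 / (x - 1) + C := by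
  have hK : IsCompact ((fun x : ℝ => (x : ℂ)) '' Set.Icc 1 2) :=
    isCompact_Icc.image Complex.continuous_ofReal
  have hc := (continuousOn_neg_logDeriv_LFunctionTrivChar₁ N).mono
    (t := (fun x : ℝ => (x : ℂ)) '' Set.Icc 1 2) (by
      rintro _ ⟨x, hx, rfl⟩
      rcases eq_or_ne (x : ℂ) 1 with h | h
      · exact Or.inl h
      · exact Or.inr (LFunction_ne_zero_of_one_le_re _ (Or.inr h) (by simpa using hx.1)))
  obtain ⟨C, hC⟩ := hK.exists_bound_of_continuousOn hc
  refine ⟨|C| + 1, by positivity, fun x hx1 hx2 => ?_⟩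
  have h1 := hC x ⟨x, ⟨hx1.le, hx2⟩, rfl⟩
  have hx : (x : ℂ) ≠ 1 := by exact_mod_cast hx1.ne'
  have hx' : (x : ℂ) - 1 ≠ 0 := sub_ne_zero.2 hx
  have hL : LFunction (1 : DirichletCharacter ℂ N) x ≠ 0 :=
    LFunction_ne_zero_of_one_le_re _ (Or.inr hx) (by simpa using hx1.le)
  have h2 : -deriv (LFunctionTrivChar₁ N) x / LFunctionTrivChar₁ N x =
      -(deriv (LFunction (1 : DirichletCharacter ℂ N)) x /
          LFunction (1 : DirichletCharacter ℂ N) x) - ((1 / (x - 1) : ℝ) : ℂ) := by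
    rw [deriv_LFunctionTrivChar₁_apply_of_ne_one N hx, LFunctionTrivChar₁,
      Function.update_of_ne hx]
    push_cast
    simp only [LFunctionTrivChar]
    field_simp
    ring
  have h3 := (Complex.re_le_norm _).trans h1
  rw [h2, Complex.sub_re, Complex.ofReal_re, Complex.neg_re] at h3
  linarith [le_abs_self C]

/-- Lower bounds for the logarithmic derivative of a Dirichlet L-function to the right of the
line `Re s = 1`. -/
lemma exists_le_re_deriv_div_LFunction :
    ∃ K : ℝ, 0 < K ∧ ∀ η t : ℝ, 0 < η → η ≤ 1 / 4 → 1 ≤ |t| →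
      -(K * (Real.log (|t| + 4) + √η⁻¹)) ≤
        (deriv (LFunction χ) ((1 + η : ℝ) + t * Complex.I) /
          LFunction χ ((1 + η : ℝ) + t * Complex.I)).re ∧
      ∀ β : ℝ, β < 1 → 1 + η - β ≤ 1 / 4 → LFunction χ (β + t * Complex.I) = 0 →
        1 / (1 + η - β) - K * (Real.log (|t| + 4) + √η⁻¹) ≤
        (deriv (LFunction χ) ((1 + η : ℝ) + t * Complex.I) /
          LFunction χ ((1 + η : ℝ) + t * Complex.I)).re := by
  obtain ⟨C, hC0, hC⟩ := χ.exists_norm_LFunction_le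
  refine ⟨2 * (|Real.log (12 * C)| + 2), by positivity, fun η t hη hη4 ht => ?_⟩
  set s₀ : ℂ := (1 + η : ℝ) + t * Complex.I with hs₀
  set f : ℂ → ℂ := fun z => LFunction χ (s₀ + z) with hf
  have hre : ∀ z : ℂ, (s₀ + z).re = 1 + η + z.re := by intro z; simp [hs₀]
  have him : ∀ z : ℂ, (s₀ + z).im = t + z.im := by intro z; simp [hs₀]
  have him2 : ∀ z : ℂ, ‖z‖ ≤ 1 / 2 → 1 / 2 ≤ |t + z.im| ∧ |t + z.im| ≤ |t| + 1 / 2 := by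
    intro z hz
    have h1 := (Complex.abs_im_le_norm z).trans hz
    have h2 := abs_sub_abs_le_abs_sub t (-z.im)
    have h3 := abs_add_le t z.im
    rw [sub_neg_eq_add, abs_neg] at h2
    constructor <;> linarith
  have hne1 : ∀ z : ℂ, ‖z‖ ≤ 1 / 2 → s₀ + z ≠ 1 := by
    intro z hz h
    have h1 := (him2 z hz).1
    rw [← him, h] at h1
    norm_num at h1
  have hd : ∀ᶠ z in nhdsSet (Metric.closedBall (0 : ℂ) (1 / 2)), DifferentiableAt ℂ f z := by
    have hO : IsOpen {z : ℂ | s₀ + z ≠ 1} :=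
      isOpen_ne_fun (by fun_prop) continuous_const
    have hsub : Metric.closedBall (0 : ℂ) (1 / 2) ⊆ {z : ℂ | s₀ + z ≠ 1} := fun z hz =>
      hne1 z (by simpa using hz)
    filter_upwards [hO.mem_nhdsSet.2 hsub] with z hz
    exact DifferentiableAt.comp z (f := fun z => s₀ + z)
      (differentiableAt_LFunction χ _ (Or.inl hz)) (by fun_prop)
  have hd' : ∀ z : ℂ, ‖z‖ ≤ 1 / 2 → DifferentiableAt ℂ f z := fun z hz =>
    hd.self_of_nhdsSet z (by simpa using hz)
  have h0 : ∀ z : ℂ, ‖z‖ ≤ 1 / 2 → 0 ≤ z.re → f z ≠ 0 := fun z hz hz0 =>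
    LFunction_ne_zero_of_one_le_re χ (Or.inr (hne1 z hz)) (by rw [hre]; linarith)
  have hM : ∀ z : ℂ, ‖z‖ = 1 / 2 → z.re ≤ 0 → ‖f z‖ ≤ 2 * C * (|t| + 4) := by
    intro z hz hz0
    have h1 := (abs_le.1 ((Complex.abs_re_le_norm z).trans hz.le)).1
    have h2 := him2 z hz.le
    refine (hC (s₀ + z) (by rw [hre]; linarith) (by rw [hre]; linarith)
      (by rw [him]; exact h2.1)).trans ?_
    rw [him]
    nlinarith
  have hm : ∀ z : ℂ, ‖z‖ = 1 / 2 → 0 ≤ z.re → η / 2 ≤ ‖f z‖ := by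
    intro z hz hz0
    have h1 := χ.sub_one_div_le_norm_LFunction (s := s₀ + z) (by rw [hre]; linarith)
    rw [hre] at h1
    have h2 := sub_one_div_le_sub_one_div (a := 1 + η) (b := 1 + η + z.re)
      (by linarith) (by linarith)
    refine le_trans ?_ (h2.trans h1)
    rw [div_le_div_iff₀ (by norm_num) (by linarith)]
    nlinarith
  have hdf : deriv f 0 / f 0 = deriv (LFunction χ) s₀ / LFunction χ s₀ := by
    simp only [hf, deriv_comp_const_add, add_zero]
  -- The term log(1/η) coming from the lower bound η/2 is traded for √(1/η). This is harmless
  -- because η√(1/η) = √η can later be made small.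
  have hlog : Real.log (3 * (2 * C * (|t| + 4)) / (η / 2)) / (1 / 2) ≤
      2 * (|Real.log (12 * C)| + 2) * (Real.log (|t| + 4) + √η⁻¹) := by
    have h1 : 3 * (2 * C * (|t| + 4)) / (η / 2) = (12 * C) * (|t| + 4) * (√η⁻¹) ^ 2 := by
      rw [Real.sq_sqrt (by positivity)]
      field_simp
      ring
    have hsq : 0 < √η⁻¹ := Real.sqrt_pos.2 (by positivity)
    rw [h1, Real.log_mul (by positivity) (by positivity), Real.log_mul (by positivity)
      (by positivity), Real.log_pow]
    have h2 := Real.log_le_sub_one_of_pos hsq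
    have h3 := le_abs_self (Real.log (12 * C))
    have h4 := one_le_log_add_four (abs_nonneg t)
    have h5 := abs_nonneg (Real.log (12 * C))
    push_cast
    nlinarith [mul_nonneg h5 hsq.le, mul_nonneg h5 (sub_nonneg.2 h4)]
  constructor
  · have key := neg_log_div_le_re_logDeriv (R := 1 / 2) (by norm_num) (by positivity) hd' h0 hM hm
    rw [hdf] at key
    refine le_trans (neg_le_neg ?_) key
    refine le_trans ?_ hlog
    have hle : 2 * C * (|t| + 4) ≤ 3 * (2 * C * (|t| + 4)) := by
      nlinarith [mul_pos hC0 (by positivity : 0 < |t| + 4)]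
    exact div_le_div_of_nonneg_right (Real.log_le_log (by positivity)
      (div_le_div_of_nonneg_right hle (by positivity))) (by norm_num)
  · intro β hβ hβ4 hz
    have key := one_div_sub_log_div_le_re_logDeriv (R := 1 / 2) (z₀ := 1 + η - β) (by norm_num)
      (by positivity) hd h0 hM hm (by linarith) (by linarith)
      (by
        simp only [hf]
        rw [← hz]
        congr 1
        simp only [hs₀]
        push_cast
        ring)
    rw [hdf] at key
    linarith

/-- The classical zero-free region for Dirichlet L-functions, away from the real axis. -/
theorem exists_LFunction_ne_zero_of_one_sub_div_log_lt :
    ∃ a : ℝ, 0 < a ∧ ∀ s : ℂ, 1 ≤ |s.im| → 1 - a / Real.log (|s.im| + 4) < s.re →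
      LFunction χ s ≠ 0 := by
  obtain ⟨K, hK0, hK⟩ := χ.exists_le_re_deriv_div_LFunction
  obtain ⟨K', hK0', hK'⟩ := (χ ^ 2).exists_le_re_deriv_div_LFunction
  obtain ⟨C, hC0, hC⟩ := exists_neg_re_deriv_div_LFunction_one_le (N := N)
  set D : ℝ := 3 * C + 8 * K + 3 * K' + 1 with hD
  have hD0 : 0 < D := by positivity
  -- After multiplication by η all error terms together stay below D·r = 1/4, whereas a zero with 1
  -- - β < η/5 would force 4/1.2 = 10/3 ≤ 3 + 1/4.
  set r : ℝ := 1 / (4 * D) with hr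
  have hr0 : 0 < r := by positivity
  have hrD : D * r = 1 / 4 := by rw [hr]; field_simp
  have hr4 : r ≤ 1 / 4 := by
    rw [hr]; apply one_div_le_one_div_of_le (by norm_num); nlinarith
  refine ⟨r ^ 2 / 5, by positivity, fun s ht hs hz => ?_⟩
  set t := s.im with ht'
  set β := s.re with hβ'
  have hsβ : s = β + t * Complex.I := (Complex.re_add_im s).symm
  have hs1 : s ≠ 1 := by
    rintro rfl; norm_num [ht'] at ht
  have hβ1 : β < 1 := by
    by_contra h
    exact LFunction_ne_zero_of_one_le_re χ (Or.inr hs1) (not_lt.1 h) hz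
  set Λ := Real.log (|t| + 4) with hΛ
  have hΛ1 : 1 ≤ Λ := one_le_log_add_four (abs_nonneg t)
  set η := r ^ 2 / Λ with hη
  have hη0 : 0 < η := by positivity
  have hηr : η ≤ r ^ 2 := div_le_self (by positivity) hΛ1
  have hη4 : η ≤ 1 / 16 := by nlinarith
  have hβη : 1 - β < η / 5 := by
    have : r ^ 2 / 5 / Λ = η / 5 := by rw [hη]; ring
    linarith
  have h1 := (hK η t hη0 (by linarith) ht).2 β hβ1 (by linarith) (by rw [← hsβ]; exact hz)
  have h2 := (hK' η (2 * t) hη0 (by linarith)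
    (by rw [abs_mul, abs_two]; linarith)).1
  have h3 := hC (1 + η) (by linarith) (by linarith)
  have h4 := χ.re_deriv_div_LFunction_comb_le (x := 1 + η) (by linarith) t
  simp only [Complex.add_re, Complex.mul_re, Complex.re_ofNat, Complex.im_ofNat, zero_mul,
    sub_zero] at h4
  have hΛ2 : Real.log (|2 * t| + 4) ≤ 2 * Λ := by
    have h : 2 * Λ = Real.log ((|t| + 4) ^ 2) := by rw [Real.log_pow]; push_cast; ring
    rw [h, abs_mul, abs_two]
    apply Real.log_le_log (by positivity)
    nlinarith [abs_nonneg t]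
  set q := √η⁻¹ with hq
  have hqη : η * q ≤ r := by
    have h5 : η * q = √η := by
      rw [hq, Real.sqrt_inv]
      rw [← div_eq_mul_inv, Real.div_sqrt]
    rw [h5]
    exact Real.sqrt_le_iff.2 ⟨hr0.le, hηr⟩
  have hηΛ : η * Λ = r ^ 2 := by rw [hη]; field_simp
  have hηΛ' : η * Λ ≤ r := by rw [hηΛ]; nlinarith
  have hz0 : 0 < 1 + η - β := by linarith
  have h6 : 1 / (1.2 * η) ≤ 1 / (1 + η - β) :=
    one_div_le_one_div_of_le hz0 (by linarith)
  have h7 : (1 + η - 1 : ℝ) = η := by ring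
  rw [h7] at h3
  have h8 : 4 * (1 / (1.2 * η)) ≤ 3 * (1 / η + C) + 4 * (K * (Λ + q)) + K' * (2 * Λ + q) := by
    have : K' * (Real.log (|2 * t| + 4) + q) ≤ K' * (2 * Λ + q) := by gcongr
    linarith
  have h9 : η * (4 * (1 / (1.2 * η))) ≤
      η * (3 * (1 / η + C) + 4 * (K * (Λ + q)) + K' * (2 * Λ + q)) := by gcongr
  have e1 : η * (4 * (1 / (1.2 * η))) = 4 / 1.2 := by field_simp
  have e2 : η * (3 * (1 / η + C) + 4 * (K * (Λ + q)) + K' * (2 * Λ + q)) =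
      3 + 3 * C * η + 4 * K * (η * Λ) + 4 * K * (η * q) + 2 * K' * (η * Λ) + K' * (η * q) := by
    field_simp
    ring
  rw [e1, e2] at h9
  have hηr' : η ≤ r := by nlinarith
  have b1 : 3 * C * η ≤ 3 * C * r := by gcongr
  have b2 : 4 * K * (η * Λ) ≤ 4 * K * r := by gcongr
  have b3 : 4 * K * (η * q) ≤ 4 * K * r := by gcongr
  have b4 : 2 * K' * (η * Λ) ≤ 2 * K' * r := by gcongr
  have b5 : K' * (η * q) ≤ K' * r := by gcongr
  have b6 : D * r = 3 * C * r + 8 * K * r + 3 * K' * r + r := by rw [hD]; ring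
  norm_num at h9
  linarith

end DirichletCharacter

/-! ### Continuation and growth of 1/L in the zero-free region. -/

namespace DirichletCharacter

variable {N : ℕ} [NeZero N] (χ : DirichletCharacter ℂ N)

/-- The factor p (s - 1 for the trivial character, 1 otherwise) cancels a possible pole, so that p/G
continues 1/L holomorphically through s = 1. -/
lemma exists_mul_LFunction_ne_zero :
    ∃ p G : ℂ → ℂ, Differentiable ℂ p ∧ Differentiable ℂ G ∧
      (∀ s, s ≠ 1 → p s ≠ 0 ∧ G s = p s * LFunction χ s) ∧ ∀ s, 1 ≤ s.re → G s ≠ 0 := by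
  by_cases hχ : χ = 1
  · subst hχ
    refine ⟨fun s => s - 1, LFunctionTrivChar₁ N, differentiable_id.sub_const 1,
      differentiable_LFunctionTrivChar₁ N,
      fun s hs => ⟨sub_ne_zero.2 hs, Function.update_of_ne hs ..⟩, fun s hs => ?_⟩
    rcases eq_or_ne s 1 with rfl | h
    · exact LFunctionTrivChar₁_apply_one_ne_zero N
    · rw [LFunctionTrivChar₁, Function.update_of_ne h]
      exact mul_ne_zero (sub_ne_zero.2 h) (LFunction_ne_zero_of_one_le_re _ (Or.inr h) hs)
  · exact ⟨fun _ => 1, LFunction χ, differentiable_const 1, differentiable_LFunction hχ,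
      fun s _ => ⟨one_ne_zero, (one_mul _).symm⟩,
      fun s hs => LFunction_ne_zero_of_one_le_re χ (Or.inl hχ) hs⟩

/-- By compactness, nonvanishing on the rectangle 1 ≤ Re s ≤ 2 persists on a closed thickening of
it. This covers bounded heights. -/
lemma exists_forall_ne_zero_and_norm_le {p G : ℂ → ℂ} (hp : Continuous p) (hG : Continuous G)
    (h0 : ∀ s, 1 ≤ s.re → G s ≠ 0) (T : ℝ) :
    ∃ δ C : ℝ, 0 < δ ∧ 0 < C ∧ ∀ s : ℂ, |s.im| ≤ T → 1 - δ ≤ s.re → s.re ≤ 2 →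
      G s ≠ 0 ∧ ‖p s / G s‖ ≤ C := by
  have hK : IsCompact (Set.Icc (1 : ℝ) 2 ×ℂ Set.Icc (-T) T) := isCompact_Icc.reProdIm isCompact_Icc
  have hU : IsOpen {s | G s ≠ 0} := isOpen_ne_fun hG continuous_const
  obtain ⟨δ, hδ, hsub⟩ := hK.exists_cthickening_subset_open hU (fun s hs => h0 s hs.1.1)
  obtain ⟨C, hC⟩ := (hK.cthickening (r := δ)).exists_bound_of_continuousOn
    (f := fun s => p s / G s) (hp.continuousOn.div hG.continuousOn fun s hs => hsub hs)
  refine ⟨δ, |C| + 1, hδ, by positivity, fun s h1 h2 h3 => ?_⟩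
  have hmem : s ∈ Metric.cthickening δ (Set.Icc (1 : ℝ) 2 ×ℂ Set.Icc (-T) T) := by
    refine Metric.mem_cthickening_of_dist_le s ⟨max s.re 1, s.im⟩ δ _
      ⟨⟨le_max_right _ _, max_le h3 (by norm_num)⟩, abs_le.1 h1⟩ ?_
    rw [dist_eq_norm]
    have : s - ⟨max s.re 1, s.im⟩ = ((s.re - max s.re 1 : ℝ) : ℂ) := by
      apply Complex.ext <;> simp
    rw [this, Complex.norm_real, Real.norm_eq_abs, abs_le]
    constructor
    · rcases max_cases s.re 1 with h | h <;> linarith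
    · linarith [le_max_left s.re 1]
  exact ⟨hsub hmem, (hC s hmem).trans (by linarith [le_abs_self C])⟩

/-- A lower bound for Dirichlet L-functions inside the zero-free region, away from the real
axis. -/
lemma exists_norm_inv_LFunction_le :
    ∃ c C : ℝ, 0 < c ∧ 0 < C ∧ ∀ s : ℂ, 2 ≤ |s.im| → 1 - c / Real.log (|s.im| + 4) ≤ s.re →
      s.re ≤ 2 → LFunction χ s ≠ 0 ∧ ‖(LFunction χ s)⁻¹‖ ≤ C * √(|s.im| + 4) := by
  obtain ⟨a, ha0, ha⟩ := χ.exists_LFunction_ne_zero_of_one_sub_div_log_lt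
  obtain ⟨C₀, hC₀, hL⟩ := χ.exists_norm_LFunction_le
  -- The ball of radius 18η about 1 + η + it reaches left to 1 - 17η, which stays zero-free because
  -- 17c < a/2; the remaining factor 2 allows for the change of height. A point with 1 - η ≤ Re s ≤
  -- 1 + η is within 2η, one ninth of the radius, of the centre.
  set c : ℝ := min (a / 36) (1 / 36) with hc
  have hc0 : 0 < c := by positivity
  have hca : c ≤ a / 36 := min_le_left _ _
  have hc1 : c ≤ 1 / 36 := min_le_right _ _
  set A : ℝ := |Real.log (2 * C₀ + 1)| + |Real.log (2 / c)| with hA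
  refine ⟨c, 16 / c * Real.exp (A / 4), hc0, by positivity, fun s ht hs hs2 => ?_⟩
  set t := s.im with ht'
  have ht0 := abs_nonneg t
  set Λ := Real.log (|t| + 4) with hΛ
  have hΛ1 : 1 ≤ Λ := one_le_log_add_four ht0
  have hexp : Real.exp Λ = |t| + 4 := Real.exp_log (by positivity)
  set η := c / Λ with hη
  have hη0 : 0 < η := by positivity
  have hηc : η ≤ c := div_le_self hc0.le hΛ1
  have hs1 : s ≠ 1 := by
    rintro rfl; norm_num [ht'] at ht
  have hne : LFunction χ s ≠ 0 := by
    refine ha s (by linarith) (lt_of_lt_of_le ?_ hs)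
    have : c / Λ < a / Λ := by gcongr; linarith
    linarith
  refine ⟨hne, ?_⟩
  set m := η / 2 with hm
  set M := (2 * C₀ + 1) * (|t| + 4) with hM
  have hmpos : 0 < m := by positivity
  have hmM : m < M := by
    have : (1 : ℝ) ≤ M := by rw [hM]; nlinarith [mul_nonneg hC₀.le (by positivity : 0 ≤ |t| + 4)]
    linarith
  have hb0 : 0 ≤ Real.log (M / m) :=
    Real.log_nonneg (by rw [le_div_iff₀ hmpos]; linarith)
  have hηm : ∀ σ : ℝ, 1 + η ≤ σ → m ≤ (σ - 1) / σ := by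
    intro σ hσ
    refine le_trans ?_ (sub_one_div_le_sub_one_div (by linarith) hσ)
    rw [hm, div_le_div_iff₀ (by norm_num) (by linarith)]
    nlinarith
  have key : m * Real.exp (-(Real.log (M / m) / 4)) ≤ ‖LFunction χ s‖ := by
    rcases le_total (1 + η) s.re with h | h
    · have h1 := (hηm _ h).trans (χ.sub_one_div_le_norm_LFunction (s := s) (by linarith))
      refine le_trans (mul_le_of_le_one_right hmpos.le (Real.exp_le_one_iff.2 ?_)) h1
      linarith
    · set s₀ : ℂ := ⟨1 + η, t⟩ with hs₀
      have hball : ∀ z ∈ Metric.ball s₀ (18 * η), 1 - 17 * η ≤ z.re ∧ z.re ≤ 2 ∧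
          1 ≤ |z.im| ∧ |z.im| ≤ |t| + 1 := by
        intro z hz
        rw [Metric.mem_ball, dist_eq_norm] at hz
        have h1 := (abs_le.1 ((Complex.abs_re_le_norm (z - s₀)).trans hz.le))
        have h2 := (Complex.abs_im_le_norm (z - s₀)).trans hz.le
        simp only [Complex.sub_re, Complex.sub_im, hs₀] at h1 h2
        have h3 := abs_sub_abs_le_abs_sub z.im t
        have h4 := abs_sub_abs_le_abs_sub t z.im
        rw [abs_sub_comm t] at h4
        refine ⟨by linarith [h1.1], by linarith [h1.2], by linarith, by linarith⟩
      have hne1 : ∀ z ∈ Metric.ball s₀ (18 * η), z ≠ 1 := by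
        rintro z hz rfl
        have := (hball _ hz).2.2.1
        norm_num at this
      refine norm_ge_of_ne_zero_on_ball (c := s₀) (ρ := 18 * η) (by positivity) hmpos hmM
        (fun z hz => (differentiableAt_LFunction χ z
          (Or.inl (hne1 z hz))).differentiableWithinAt) (fun z hz => ?_) (fun z hz => ?_) ?_ ?_
      · obtain ⟨h1, h2, h3, h4⟩ := hball z hz
        refine ha z h3 (lt_of_lt_of_le ?_ h1)
        have h5 : Real.log (|z.im| + 4) ≤ 2 * Λ := by
          have h6 : 2 * Λ = Real.log ((|t| + 4) ^ 2) := by rw [Real.log_pow]; push_cast; ring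
          rw [h6]
          apply Real.log_le_log (by positivity)
          nlinarith
        have h7 := one_le_log_add_four (abs_nonneg z.im)
        have h8 : a / (2 * Λ) ≤ a / Real.log (|z.im| + 4) := by gcongr
        have h9 : 17 * η < a / (2 * Λ) := by
          rw [hη, ← mul_div_assoc, div_lt_div_iff₀ (by positivity) (by positivity)]
          nlinarith
        linarith
      · obtain ⟨h1, h2, h3, h4⟩ := hball z hz
        refine (hL z (by linarith) h2 (by linarith)).trans ?_
        rw [hM]
        nlinarith [mul_nonneg hC₀.le ht0]
      · have h1 : (1 : ℝ) < s₀.re := by simp [hs₀, hη0]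
        exact (hηm s₀.re le_rfl).trans (χ.sub_one_div_le_norm_LFunction h1)
      · have : s - s₀ = ((s.re - (1 + η) : ℝ) : ℂ) := by
          apply Complex.ext <;> simp [hs₀, ht']
        rw [this, Complex.norm_real, Real.norm_eq_abs, abs_le]
        constructor <;> linarith
  -- The quarter from Borel–Carathéodory turns Λ + log Λ ≤ 3Λ/2 into 3Λ/8. The prefactor Λ costs
  -- another Λ/8, and exp(Λ/2) = √(|t| + 4).
  have hA' : Real.log (M / m) / 4 ≤ A / 4 + 3 * Λ / 8 := by
    have h1 : M / m = (2 * C₀ + 1) * (|t| + 4) * (2 / c) * Λ := by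
      rw [hM, hm, hη]; field_simp
    have h2 : Real.log Λ ≤ Λ / 2 := by
      have h3 := Real.log_le_sub_one_of_pos (show 0 < Λ / 2 by positivity)
      rw [Real.log_div (by positivity) (by norm_num)] at h3
      linarith [Real.log_two_lt_d9]
    rw [h1, Real.log_mul (by positivity) (by positivity), Real.log_mul (by positivity)
      (by positivity), Real.log_mul (by positivity) (by positivity)]
    linarith [le_abs_self (Real.log (2 * C₀ + 1)), le_abs_self (Real.log (2 / c))]
  have hsqrt : √(|t| + 4) = Real.exp (Λ / 2) := by rw [Real.exp_half, hexp]
  rw [norm_inv, hsqrt]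
  have hLpos := norm_pos_iff.2 hne
  calc ‖LFunction χ s‖⁻¹ ≤ (m * Real.exp (-(Real.log (M / m) / 4)))⁻¹ := by gcongr
    _ = 2 / c * Λ * Real.exp (Real.log (M / m) / 4) := by
      rw [Real.exp_neg, hm, hη]; field_simp
    _ ≤ 2 / c * (8 * Real.exp (Λ / 8)) * Real.exp (A / 4 + 3 * Λ / 8) := by
      gcongr
      have := Real.add_one_le_exp (Λ / 8)
      linarith
    _ = 16 / c * Real.exp (A / 4) * Real.exp (Λ / 2) := by
      have : Real.exp (Λ / 2) = Real.exp (Λ / 8) * Real.exp (3 * Λ / 8) := by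
        rw [← Real.exp_add]; congr 1; ring
      rw [this, Real.exp_add]; ring

/-- The inverse of a Dirichlet L-function is holomorphic and of moderate growth in the classical
zero-free region. -/
theorem exists_inv_LFunction_extension :
    ∃ (W : ℂ → ℂ) (c C : ℝ), 0 < c ∧ 0 < C ∧ (∀ s, 1 < s.re → W s = (LFunction χ s)⁻¹) ∧
      ∀ s : ℂ, 1 - c / Real.log (|s.im| + 4) ≤ s.re → s.re ≤ 2 →
        DifferentiableAt ℂ W s ∧ ‖W s‖ ≤ C * √(|s.im| + 4) := by
  obtain ⟨p, G, hp, hG, hpG, hG0⟩ := χ.exists_mul_LFunction_ne_zero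
  obtain ⟨δ, C₁, hδ, hC₁, hlow⟩ := exists_forall_ne_zero_and_norm_le hp.continuous hG.continuous
    hG0 2
  obtain ⟨c, C₂, hc, hC₂, hhigh⟩ := χ.exists_norm_inv_LFunction_le
  have hW : ∀ s, s ≠ 1 → p s / G s = (LFunction χ s)⁻¹ := by
    intro s hs
    obtain ⟨h1, h2⟩ := hpG s hs
    rw [h2, div_mul_eq_div_div, div_self h1, one_div]
  refine ⟨fun s => p s / G s, min δ c, C₁ + C₂, by positivity, by positivity,
    fun s hs => hW s (by rintro rfl; simp at hs), fun s h1 h2 => ?_⟩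
  have hΛ1 := one_le_log_add_four (abs_nonneg s.im)
  have hsq : 1 ≤ √(|s.im| + 4) := by
    rw [Real.one_le_sqrt]; linarith [abs_nonneg s.im]
  suffices h : G s ≠ 0 ∧ ‖p s / G s‖ ≤ (C₁ + C₂) * √(|s.im| + 4) from
    ⟨(hp s).div (hG s) h.1, h.2⟩
  rcases le_total |s.im| 2 with h | h
  · have h3 : min δ c / Real.log (|s.im| + 4) ≤ δ :=
      (div_le_self (by positivity) hΛ1).trans (min_le_left _ _)
    obtain ⟨h4, h5⟩ := hlow s h (by linarith) h2
    exact ⟨h4, h5.trans (by nlinarith)⟩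
  · have h3 : min δ c / Real.log (|s.im| + 4) ≤ c / Real.log (|s.im| + 4) := by
      gcongr; exact min_le_right _ _
    obtain ⟨h4, h5⟩ := hhigh s h (by linarith) h2
    have hs1 : s ≠ 1 := by
      rintro rfl; norm_num at h
    refine ⟨?_, ?_⟩
    · rw [(hpG s hs1).2]; exact mul_ne_zero (hpG s hs1).1 h4
    · rw [hW s hs1]; exact h5.trans (by nlinarith)

end DirichletCharacter

/-! ### Riesz means by Mellin inversion. -/

section RieszMean

open MeasureTheory

lemma one_add_sq_le_norm_mul {s : ℂ} (hs : 1 / 2 ≤ s.re) :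
    (1 + s.im ^ 2) / 4 ≤ ‖s * (s + 1)‖ := by
  have h1 : ‖s‖ ^ 2 = s.re ^ 2 + s.im ^ 2 := by
    rw [Complex.sq_norm, Complex.normSq_apply]; ring
  have h2 : ‖s‖ ≤ ‖s + 1‖ := by
    rw [← sq_le_sq₀ (norm_nonneg _) (norm_nonneg _), h1, Complex.sq_norm, Complex.normSq_apply]
    simp only [Complex.add_re, Complex.one_re, Complex.add_im, Complex.one_im]
    nlinarith
  rw [norm_mul]
  nlinarith [norm_nonneg s]

lemma mul_add_one_ne_zero {s : ℂ} (hs : 1 / 2 ≤ s.re) : s * (s + 1) ≠ 0 := by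
  rw [← norm_pos_iff]
  exact lt_of_lt_of_le (by positivity) (one_add_sq_le_norm_mul hs)

lemma norm_inv_mul_add_one_le (σ : ℝ) (hσ : 1 / 2 ≤ σ) (y : ℝ) :
    ‖(((σ : ℂ) + y * Complex.I) * (σ + y * Complex.I + 1))⁻¹‖ ≤ 4 * (1 + y ^ 2)⁻¹ := by
  have h := one_add_sq_le_norm_mul (s := (σ : ℂ) + y * Complex.I) (by simpa using hσ)
  simp only [Complex.add_im, Complex.ofReal_im, Complex.mul_im, Complex.ofReal_re, Complex.I_im,
    mul_one, Complex.I_re, mul_zero, add_zero, zero_add] at h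
  rw [norm_inv, show 4 * (1 + y ^ 2)⁻¹ = ((1 + y ^ 2) / 4)⁻¹ by rw [inv_div]; ring]
  exact inv_anti₀ (by positivity) h

lemma integrable_inv_mul_add_one (σ : ℝ) (hσ : 1 / 2 ≤ σ) :
    Integrable (fun y : ℝ => (((σ : ℂ) + y * Complex.I) * (σ + y * Complex.I + 1))⁻¹) := by
  refine Integrable.mono' (integrable_inv_one_add_sq.const_mul 4) ?_
    (Eventually.of_forall (norm_inv_mul_add_one_le σ hσ))
  apply Measurable.aestronglyMeasurable
  fun_prop

/-- Mellin inversion for the function `max 0 (1 - u)`. -/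
lemma integral_cpow_neg_mul_inv (σ : ℝ) (hσ : 1 / 2 ≤ σ) {u : ℝ} (hu : 0 < u) :
    ∫ y : ℝ, (u : ℂ) ^ (-((σ : ℂ) + y * Complex.I)) *
      (((σ : ℂ) + y * Complex.I) * (σ + y * Complex.I + 1))⁻¹ =
      2 * Real.pi * (max 0 (1 - u) : ℝ) := by
  -- On t > 0 this is max 0 (1 - t), written so that its transform is 1/s - 1/(s + 1).
  set f : ℝ → ℂ := fun t => (Set.Ioc 0 1).indicator (fun _ => (1 : ℂ)) t -
    (Set.Ioc 0 1).indicator (fun t : ℝ => (t : ℂ) ^ (1 : ℂ)) t with hf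
  have hfe : ∀ t : ℝ, 0 < t → f t = (max 0 (1 - t) : ℝ) := by
    intro t ht
    by_cases h1 : t ≤ 1
    · have hm : t ∈ Set.Ioc (0 : ℝ) 1 := ⟨ht, h1⟩
      simp only [hf]
      rw [Set.indicator_of_mem hm, Set.indicator_of_mem hm,
        max_eq_right (by linarith), Complex.cpow_one]
      push_cast; rfl
    · simp only [hf]
      rw [Set.indicator_of_notMem (fun h => h1 h.2), Set.indicator_of_notMem (fun h => h1 h.2),
        max_eq_left (by linarith)]
      simp
  have hmel : ∀ s : ℂ, 1 / 2 ≤ s.re → HasMellin f s (s * (s + 1))⁻¹ := by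
    intro s hs
    have h1 := hasMellin_one_Ioc (s := s) (by linarith)
    have h2 := hasMellin_cpow_Ioc 1 (s := s) (by simp; linarith)
    have h3 := hasMellin_sub h1.1 h2.1
    refine ⟨h3.1, h3.2.trans ?_⟩
    rw [h1.2, h2.2]
    have := mul_add_one_ne_zero hs
    have hs0 : s ≠ 0 := left_ne_zero_of_mul this
    have hs1 : s + 1 ≠ 0 := right_ne_zero_of_mul this
    field_simp
    ring
  have hmy : ∀ y : ℝ, mellin f ((σ : ℂ) + y * Complex.I) =
      (((σ : ℂ) + y * Complex.I) * (σ + y * Complex.I + 1))⁻¹ := fun y =>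
    (hmel _ (by simpa using hσ)).2
  have hcont : ContinuousAt f u := by
    have h1 : ContinuousAt (fun t : ℝ => ((max 0 (1 - t) : ℝ) : ℂ)) u := by fun_prop
    refine h1.congr ?_
    filter_upwards [Ioi_mem_nhds hu] with t ht
    exact (hfe t ht).symm
  have key := mellinInv_mellin_eq σ f hu (hmel σ (by simpa using hσ)).1
    (by
      rw [Complex.VerticalIntegrable]
      simp only [hmy]
      exact integrable_inv_mul_add_one σ hσ) hcont
  rw [hfe u hu, mellinInv] at key
  simp only [hmy, smul_eq_mul] at key
  have hpi : (2 * Real.pi : ℂ) * ((1 / (2 * Real.pi) : ℝ) : ℂ) = 1 := by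
    have : (Real.pi : ℂ) ≠ 0 := by exact_mod_cast Real.pi_ne_zero
    push_cast
    field_simp
  rw [← key, Complex.real_smul, ← mul_assoc, hpi, one_mul]

/-- An integral formula for the Riesz means of the coefficients of a Dirichlet series. -/
lemma sum_mul_one_sub_div_eq_integral {a : ℕ → ℂ} (ha : ∀ n, ‖a n‖ ≤ 1) {σ : ℝ} (hσ : 1 < σ)
    {X : ℝ} (hX : 0 < X) :
    2 * Real.pi * ∑ n ∈ Finset.Icc 1 ⌊X⌋₊, a n * (1 - n / X) =
      ∫ y : ℝ, (X : ℂ) ^ ((σ : ℂ) + y * Complex.I) * LSeries a (σ + y * Complex.I) *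
        (((σ : ℂ) + y * Complex.I) * (σ + y * Complex.I + 1))⁻¹ := by
  set k : ℝ → ℂ := fun y => (((σ : ℂ) + y * Complex.I) * (σ + y * Complex.I + 1))⁻¹ with hk
  have hki : Integrable k := integrable_inv_mul_add_one σ (by linarith)
  have hXc : (X : ℂ) ≠ 0 := by exact_mod_cast hX.ne'
  set F : ℕ → ℝ → ℂ := fun n y => (X : ℂ) ^ ((σ : ℂ) + y * Complex.I) *
    LSeries.term a (σ + y * Complex.I) n * k y with hF
  have hF0 : ∀ y, F 0 y = 0 := fun y => by simp [hF]
  have hFn : ∀ n, n ≠ 0 → ∀ y, F n y =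
      a n * (((n / X : ℝ) : ℂ) ^ (-((σ : ℂ) + y * Complex.I)) * k y) := by
    intro n hn y
    have hnr : (0 : ℝ) < n := by exact_mod_cast Nat.pos_of_ne_zero hn
    simp only [hF]
    rw [LSeries.term_of_ne_zero hn, Complex.ofReal_div, Complex.div_cpow_ofReal_nonneg hnr.le hX.le,
      Complex.cpow_neg, Complex.cpow_neg]
    have h1 : ((n : ℝ) : ℂ) ^ ((σ : ℂ) + y * Complex.I) ≠ 0 := by
      rw [Complex.cpow_ne_zero_iff]; left; exact_mod_cast hnr.ne'
    have h2 : (X : ℂ) ^ ((σ : ℂ) + y * Complex.I) ≠ 0 := by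
      rw [Complex.cpow_ne_zero_iff]; left; exact hXc
    simp only [Complex.ofReal_natCast] at h1 ⊢
    field_simp
  have hFnorm : ∀ n y, ‖F n y‖ = X ^ σ * ‖LSeries.term a σ n‖ * ‖k y‖ := by
    intro n y
    simp only [hF]
    rw [norm_mul, norm_mul, Complex.norm_cpow_eq_rpow_re_of_pos hX, LSeries.norm_term_eq,
      LSeries.norm_term_eq]
    simp
  have hFm : ∀ n, AEStronglyMeasurable (F n) := by
    intro n
    rcases eq_or_ne n 0 with rfl | hn
    · simp only [funext hF0]; exact aestronglyMeasurable_const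
    · apply Measurable.aestronglyMeasurable
      rw [funext (hFn n hn)]
      simp only [hk]
      fun_prop
  have hFi : ∀ n, Integrable (F n) := fun n =>
    Integrable.mono' (hki.norm.const_mul (X ^ σ * ‖LSeries.term a σ n‖)) (hFm n)
      (Eventually.of_forall fun y => (hFnorm n y).le)
  have hsum : Summable (LSeries.term a σ) :=
    LSeriesSummable_of_bounded_of_one_lt_re (m := 1) (fun n _ => ha n) (by simpa using hσ)
  have hFs : Summable fun n => ∫ y, ‖F n y‖ := by
    simp only [hFnorm, integral_const_mul]
    exact (hsum.norm.mul_left _).mul_right _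
  have key := integral_tsum_of_summable_integral_norm hFi hFs
  have hR : ∀ y : ℝ, ∑' n, F n y = (X : ℂ) ^ ((σ : ℂ) + y * Complex.I) *
      LSeries a (σ + y * Complex.I) * k y := by
    intro y
    simp only [hF]
    rw [tsum_mul_right, tsum_mul_left, LSeries]
  simp only [hR] at key
  rw [← key]
  have hint : ∀ n, n ≠ 0 → ∫ y, F n y = a n * (2 * Real.pi * (max 0 (1 - n / X) : ℝ)) := by
    intro n hn
    have hnr : (0 : ℝ) < n := by exact_mod_cast Nat.pos_of_ne_zero hn
    simp only [hFn n hn]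
    rw [integral_const_mul, integral_cpow_neg_mul_inv σ (by linarith) (by positivity)]
  rw [tsum_eq_sum (s := Finset.Icc 1 ⌊X⌋₊), Finset.mul_sum]
  · refine Finset.sum_congr rfl fun n hn => ?_
    obtain ⟨h1, h2⟩ := Finset.mem_Icc.1 hn
    have h3 : (n : ℝ) ≤ X := (Nat.le_floor_iff hX.le).1 h2
    rw [hint n (by lia), max_eq_right (by rw [sub_nonneg, div_le_one hX]; exact h3)]
    push_cast
    ring
  · intro n hn
    rcases eq_or_ne n 0 with rfl | h0
    · simp [hF0]
    · rw [hint n h0, max_eq_left]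
      · simp
      · have h1 : ⌊X⌋₊ < n := by
          by_contra h
          exact hn (Finset.mem_Icc.2 ⟨Nat.one_le_iff_ne_zero.2 h0, not_lt.1 h⟩)
        have h2 : X < n := (Nat.floor_lt hX.le).1 h1
        rw [sub_nonpos, one_le_div hX]
        exact h2.le

end RieszMean

/-! ### Shifting the contour into the zero-free region. -/

section ContourShift

open MeasureTheory

/-- Growth √|y| against the kernel leaves decay of order 3/2: 5/4 is enough to integrate, and 1/4
remains as the saving in the tails. -/
lemma sqrt_mul_inv_one_add_sq_le (y : ℝ) :
    √(|y| + 4) * (4 * (1 + y ^ 2)⁻¹) ≤ 16 * (1 + ‖y‖) ^ (-(3 / 2) : ℝ) := by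
  rw [Real.norm_eq_abs]
  set q := 1 + |y| with hq
  have hq0 : 0 < q := by positivity
  have h1 : √(|y| + 4) ≤ 2 * √q := by
    rw [Real.sqrt_le_left (by positivity), mul_pow, Real.sq_sqrt hq0.le, hq]
    linarith [abs_nonneg y]
  have h2 : (1 + y ^ 2)⁻¹ ≤ 2 * (q ^ 2)⁻¹ := by
    rw [show 2 * (q ^ 2)⁻¹ = (q ^ 2 / 2)⁻¹ by rw [inv_div]; ring]
    apply inv_anti₀ (by positivity)
    rw [hq]
    nlinarith [sq_abs y, sq_nonneg (|y| - 1)]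
  have h3 : q ^ (-(3 / 2) : ℝ) = √q * (q ^ 2)⁻¹ := by
    rw [Real.sqrt_eq_rpow, ← Real.rpow_natCast, ← Real.rpow_neg hq0.le, ← Real.rpow_add hq0]
    norm_num
  rw [h3]
  calc _ ≤ (2 * √q) * (4 * (2 * (q ^ 2)⁻¹)) := by gcongr
    _ = _ := by ring

lemma integrable_one_add_norm_rpow {r : ℝ} (hr : 1 < r) :
    Integrable (fun y : ℝ => (1 + ‖y‖) ^ (-r)) :=
  integrable_one_add_norm (by simpa using hr)

variable {W : ℂ → ℂ} {c C : ℝ}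

lemma norm_cpow_mul_mul_inv_le (hC : 0 < C) {X : ℝ} (hX : 0 < X) {σ y : ℝ} (hσ : 1 / 2 ≤ σ)
    (hW : ‖W (σ + y * Complex.I)‖ ≤ C * √(|y| + 4)) :
    ‖(X : ℂ) ^ ((σ : ℂ) + y * Complex.I) * W (σ + y * Complex.I) *
        (((σ : ℂ) + y * Complex.I) * (σ + y * Complex.I + 1))⁻¹‖ ≤
      16 * C * X ^ σ * (1 + ‖y‖) ^ (-(3 / 2) : ℝ) := by
  have h1 := norm_inv_mul_add_one_le σ hσ y
  rw [norm_mul, norm_mul, Complex.norm_cpow_eq_rpow_re_of_pos hX]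
  simp only [Complex.add_re, Complex.ofReal_re, Complex.mul_re, Complex.I_re, mul_zero,
    Complex.ofReal_im, Complex.I_im, mul_one, sub_self, add_zero]
  have hXσ : 0 < X ^ σ := Real.rpow_pos_of_pos hX σ
  calc _ ≤ X ^ σ * (C * √(|y| + 4)) * (4 * (1 + y ^ 2)⁻¹) := by gcongr
    _ = C * X ^ σ * (√(|y| + 4) * (4 * (1 + y ^ 2)⁻¹)) := by ring
    _ ≤ C * X ^ σ * (16 * (1 + ‖y‖) ^ (-(3 / 2) : ℝ)) :=
        mul_le_mul_of_nonneg_left (sqrt_mul_inv_one_add_sq_le y) (by positivity)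
    _ = _ := by ring

/-- Shifting the line of integration to the left inside a zero-free region. -/
lemma exists_norm_integral_le_of_region (hc : 0 < c) (hc2 : c ≤ 1 / 2) (hC : 0 < C)
    (hW : ∀ s : ℂ, 1 - c / Real.log (|s.im| + 4) ≤ s.re → s.re ≤ 2 →
      DifferentiableAt ℂ W s ∧ ‖W s‖ ≤ C * √(|s.im| + 4)) :
    ∃ K : ℝ, 0 < K ∧ ∀ X T : ℝ, Real.exp 1 ≤ X → 0 < T →
      ‖∫ y : ℝ, (X : ℂ) ^ (((1 + 1 / Real.log X : ℝ) : ℂ) + y * Complex.I) *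
          W ((1 + 1 / Real.log X : ℝ) + y * Complex.I) *
          ((((1 + 1 / Real.log X : ℝ) : ℂ) + y * Complex.I) *
            ((1 + 1 / Real.log X : ℝ) + y * Complex.I + 1))⁻¹‖ ≤
        K * X * ((1 + T) ^ (-(1 / 4) : ℝ) + Real.exp (-(c * Real.log X / Real.log (T + 4)))) := by
  set I₁ := ∫ y : ℝ, (1 + ‖y‖) ^ (-(5 / 4) : ℝ) with hI₁
  set I₂ := ∫ y : ℝ, (1 + ‖y‖) ^ (-(3 / 2) : ℝ) with hI₂
  have hi₁ := integrable_one_add_norm_rpow (r := 5 / 4) (by norm_num)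
  have hi₂ := integrable_one_add_norm_rpow (r := 3 / 2) (by norm_num)
  have hI₁0 : 0 ≤ I₁ := integral_nonneg fun y => by positivity
  have hI₂0 : 0 ≤ I₂ := integral_nonneg fun y => by positivity
  set e := Real.exp 1 with he
  have he0 : 0 < e := Real.exp_pos 1
  refine ⟨16 * C * e * (I₁ + 4 + I₂), by positivity, fun X T hX hT => ?_⟩
  have hX0 : 0 < X := he0.trans_le hX
  set L := Real.log X with hL
  have hL1 : 1 ≤ L := by rw [hL, Real.le_log_iff_exp_le hX0]; exact hX
  have hΛ1 : 1 ≤ Real.log (T + 4) := one_le_log_add_four hT.le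
  set σ₁ : ℝ := 1 + 1 / L with hσ₁
  -- The region is narrowest at |y| = T, so this abscissa is admissible at all heights up to T.
  set σ₀ : ℝ := 1 - c / Real.log (T + 4) with hσ₀
  have hσ₁1 : 1 < σ₁ := by rw [hσ₁]; linarith [one_div_pos.2 (zero_lt_one.trans_le hL1)]
  have hσ₁2 : σ₁ ≤ 2 := by
    have : 1 / L ≤ 1 := (div_le_one (by linarith)).2 hL1
    rw [hσ₁]; linarith
  have hcT : c / Real.log (T + 4) ≤ c := div_le_self hc.le hΛ1
  have hcT0 : 0 < c / Real.log (T + 4) := by positivity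
  have hσ₀h : 1 / 2 ≤ σ₀ := by rw [hσ₀]; linarith
  have hσ₀1 : σ₀ < 1 := by rw [hσ₀]; linarith
  have hXσ₁ : X ^ σ₁ = e * X := by
    rw [hσ₁, Real.rpow_add hX0, Real.rpow_one, Real.rpow_def_of_pos hX0, ← hL, mul_one_div,
      div_self (by positivity), mul_comm]
  have hXσ₀ : X ^ σ₀ = X * Real.exp (-(c * L / Real.log (T + 4))) := by
    rw [hσ₀, sub_eq_add_neg, Real.rpow_add hX0, Real.rpow_one, Real.rpow_def_of_pos hX0, ← hL]
    congr 2
    ring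
  set G : ℂ → ℂ := fun s => (X : ℂ) ^ s * W s * (s * (s + 1))⁻¹ with hG
  have hreg : ∀ σ y : ℝ, σ₀ ≤ σ → |y| ≤ T →
      1 - c / Real.log (|((σ : ℂ) + y * Complex.I).im| + 4) ≤ ((σ : ℂ) + y * Complex.I).re := by
    intro σ y hσ hy
    have h1 := one_le_log_add_four (abs_nonneg y)
    have h2 : c / Real.log (T + 4) ≤ c / Real.log (|y| + 4) := by gcongr
    simp only [Complex.add_im, Complex.ofReal_im, Complex.mul_im, Complex.ofReal_re, Complex.I_im,
      mul_one, Complex.I_re, mul_zero, add_zero, zero_add, Complex.add_re, Complex.mul_re,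
      sub_self]
    linarith
  have hreg₁ : ∀ y : ℝ, 1 - c / Real.log (|((σ₁ : ℂ) + y * Complex.I).im| + 4) ≤
      ((σ₁ : ℂ) + y * Complex.I).re := by
    intro y
    have h1 := one_le_log_add_four (abs_nonneg ((σ₁ : ℂ) + y * Complex.I).im)
    have h2 : 0 < c / Real.log (|((σ₁ : ℂ) + y * Complex.I).im| + 4) := by positivity
    have h3 : ((σ₁ : ℂ) + y * Complex.I).re = σ₁ := by simp
    rw [h3]
    linarith
  have hGd : ∀ s : ℂ, 1 - c / Real.log (|s.im| + 4) ≤ s.re → 1 / 2 ≤ s.re → s.re ≤ 2 →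
      DifferentiableAt ℂ G s := by
    intro s h1 h2 h3
    have hXc : (X : ℂ) ≠ 0 := by exact_mod_cast hX0.ne'
    have h4 := mul_add_one_ne_zero h2
    have h5 := (hW s h1 h3).1
    have h6 : DifferentiableAt ℂ (fun s : ℂ => (X : ℂ) ^ s) s :=
      differentiableAt_id.const_cpow (Or.inl hXc)
    have h7 : DifferentiableAt ℂ (fun s : ℂ => (s * (s + 1))⁻¹) s :=
      DifferentiableAt.inv (by fun_prop) h4
    exact (h6.mul h5).mul h7
  have hGn : ∀ σ y : ℝ, 1 / 2 ≤ σ → σ ≤ 2 →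
      1 - c / Real.log (|((σ : ℂ) + y * Complex.I).im| + 4) ≤ ((σ : ℂ) + y * Complex.I).re →
      ‖G (σ + y * Complex.I)‖ ≤ 16 * C * X ^ σ * (1 + ‖y‖) ^ (-(3 / 2) : ℝ) := by
    intro σ y h1 h2 h3
    refine norm_cpow_mul_mul_inv_le hC hX0 h1 ?_
    simpa using (hW _ h3 (by simpa using h2)).2
  have hGc : Continuous fun y : ℝ => G (σ₁ + y * Complex.I) := by
    rw [continuous_iff_continuousAt]
    intro y
    have h1 := (hGd (σ₁ + y * Complex.I) (hreg₁ y) (by simp; linarith) (by simpa)).continuousAt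
    exact ContinuousAt.comp (f := fun y : ℝ => (σ₁ : ℂ) + y * Complex.I) h1 (by fun_prop)
  have hGi : Integrable fun y : ℝ => G (σ₁ + y * Complex.I) :=
    Integrable.mono' (hi₂.const_mul (16 * C * X ^ σ₁)) hGc.aestronglyMeasurable
      (Eventually.of_forall fun y => hGn σ₁ y (by linarith) hσ₁2 (hreg₁ y))
  -- the tails
  have htail : ‖∫ y in (Set.Ioc (-T) T)ᶜ, G (σ₁ + y * Complex.I)‖ ≤
      16 * C * (e * X) * (1 + T) ^ (-(1 / 4) : ℝ) * I₁ := by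
    have h1 : ∀ y ∈ (Set.Ioc (-T) T)ᶜ, ‖G (σ₁ + y * Complex.I)‖ ≤
        16 * C * (e * X) * (1 + T) ^ (-(1 / 4) : ℝ) * (1 + ‖y‖) ^ (-(5 / 4) : ℝ) := by
      intro y hy
      have hTy : T ≤ ‖y‖ := by
        rw [Real.norm_eq_abs]
        by_contra h
        have := abs_lt.1 (not_le.1 h)
        exact hy ⟨this.1, this.2.le⟩
      refine (hGn σ₁ y (by linarith) hσ₁2 (hreg₁ y)).trans ?_
      rw [hXσ₁, mul_assoc (16 * C * (e * X)),
        show (-(3 / 2) : ℝ) = -(1 / 4) + -(5 / 4) by norm_num, Real.rpow_add (by positivity)]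
      have h2 : (1 + ‖y‖) ^ (-(1 / 4) : ℝ) ≤ (1 + T) ^ (-(1 / 4) : ℝ) :=
        Real.rpow_le_rpow_of_nonpos (by linarith) (by linarith) (by norm_num)
      gcongr
    calc _ ≤ ∫ y in (Set.Ioc (-T) T)ᶜ,
          16 * C * (e * X) * (1 + T) ^ (-(1 / 4) : ℝ) * (1 + ‖y‖) ^ (-(5 / 4) : ℝ) :=
        norm_integral_le_of_norm_le (hi₁.const_mul _).integrableOn
          ((ae_restrict_mem measurableSet_Ioc.compl).mono h1)
      _ ≤ ∫ y, 16 * C * (e * X) * (1 + T) ^ (-(1 / 4) : ℝ) * (1 + ‖y‖) ^ (-(5 / 4) : ℝ) :=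
        setIntegral_le_integral (hi₁.const_mul _) (Eventually.of_forall fun y => by positivity)
      _ = _ := integral_const_mul _ _
  -- the horizontal sides
  have hhor : ∀ y : ℝ, |y| = T → ‖∫ x in σ₀..σ₁, G (x + y * Complex.I)‖ ≤
      16 * C * (e * X) * (1 + T) ^ (-(1 / 4) : ℝ) * 2 := by
    intro y hy
    have h1 : ∀ x ∈ Set.uIoc σ₀ σ₁, ‖G (x + y * Complex.I)‖ ≤
        16 * C * (e * X) * (1 + T) ^ (-(1 / 4) : ℝ) := by
      intro x hx
      rw [Set.uIoc_of_le (by linarith)] at hx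
      refine (hGn x y (by linarith [hx.1]) (by linarith [hx.2])
        (hreg x y hx.1.le hy.le)).trans ?_
      rw [Real.norm_eq_abs, hy, ← hXσ₁]
      have h2 : X ^ x ≤ X ^ σ₁ :=
        Real.rpow_le_rpow_of_exponent_le (by linarith [Real.add_one_le_exp (1 : ℝ)]) hx.2
      have h3 : (1 + T) ^ (-(3 / 2) : ℝ) ≤ (1 + T) ^ (-(1 / 4) : ℝ) :=
        Real.rpow_le_rpow_of_exponent_le (by linarith) (by norm_num)
      gcongr
    refine (intervalIntegral.norm_integral_le_of_norm_le_const h1).trans ?_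
    rw [abs_of_nonneg (by linarith)]
    gcongr
    linarith
  -- the left side
  have hleft : ‖∫ y in (-T)..T, G (σ₀ + y * Complex.I)‖ ≤ 16 * C * X ^ σ₀ * I₂ := by
    rw [intervalIntegral.integral_of_le (by linarith)]
    calc _ ≤ ∫ y in Set.Ioc (-T) T, 16 * C * X ^ σ₀ * (1 + ‖y‖) ^ (-(3 / 2) : ℝ) := by
          refine norm_integral_le_of_norm_le (hi₂.const_mul _).integrableOn
            ((ae_restrict_mem measurableSet_Ioc).mono fun y hy => ?_)
          exact hGn σ₀ y hσ₀h (by linarith) (hreg σ₀ y le_rfl (abs_le.2 ⟨hy.1.le, hy.2⟩))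
      _ ≤ ∫ y, 16 * C * X ^ σ₀ * (1 + ‖y‖) ^ (-(3 / 2) : ℝ) :=
        setIntegral_le_integral (hi₂.const_mul _) (Eventually.of_forall fun y => by positivity)
      _ = _ := integral_const_mul _ _
  have hrect := Complex.integral_boundary_rect_eq_zero_of_differentiableOn G ⟨σ₀, -T⟩ ⟨σ₁, T⟩
    (by
      intro s hs
      rw [Set.uIcc_of_le (by simp; linarith), Set.uIcc_of_le (by simp; linarith)] at hs
      obtain ⟨hs1, hs2⟩ := hs
      have h1 := hreg s.re s.im hs1.1 (abs_le.2 hs2)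
      rw [Complex.re_add_im] at h1
      exact (hGd s h1 (hσ₀h.trans hs1.1) (le_trans hs1.2 hσ₁2)).differentiableWithinAt)
  simp only [smul_eq_mul] at hrect
  have hb := hhor (-T) (by rw [abs_neg, abs_of_pos hT])
  have ht := hhor T (abs_of_pos hT)
  have hsplit := integral_add_compl (μ := volume) (measurableSet_Ioc (a := -T) (b := T)) hGi
  rw [← intervalIntegral.integral_of_le (by linarith)] at hsplit
  have hmid : ‖∫ y in (-T)..T, G (σ₁ + y * Complex.I)‖ ≤
      16 * C * (e * X) * (1 + T) ^ (-(1 / 4) : ℝ) * 4 + 16 * C * X ^ σ₀ * I₂ := by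
    set A := ∫ x in σ₀..σ₁, G (x + (-T : ℝ) * Complex.I) with hA
    set B := ∫ x in σ₀..σ₁, G (x + T * Complex.I) with hB
    set D := ∫ y in (-T)..T, G (σ₀ + y * Complex.I) with hD
    have h1 : ∫ y in (-T)..T, G (σ₁ + y * Complex.I) = D + Complex.I * (A - B) := by
      have h2 : Complex.I * Complex.I = -1 := Complex.I_mul_I
      linear_combination (-Complex.I) * hrect + (-D + ∫ y in (-T)..T, G (σ₁ + y * Complex.I)) * h2
    rw [h1]
    calc _ ≤ ‖D‖ + ‖Complex.I * (A - B)‖ := norm_add_le _ _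
      _ ≤ ‖D‖ + (‖A‖ + ‖B‖) := by
        rw [norm_mul, Complex.norm_I, one_mul]
        gcongr
        exact norm_sub_le _ _
      _ ≤ _ := by linarith
  change ‖∫ y : ℝ, G (σ₁ + y * Complex.I)‖ ≤ _
  rw [← hsplit]
  refine (norm_add_le _ _).trans ((add_le_add hmid htail).trans ?_)
  rw [hXσ₀]
  have he1 : 1 ≤ e := by linarith [Real.add_one_le_exp (1 : ℝ)]
  set u := (1 + T) ^ (-(1 / 4) : ℝ) with hu
  set v := Real.exp (-(c * L / Real.log (T + 4))) with hv
  have hu0 : 0 ≤ u := by positivity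
  have hv0 : 0 ≤ v := by positivity
  have hCX : 0 < 16 * C * X := by positivity
  have h1 : I₂ * v ≤ e * I₂ * v := by
    have := mul_nonneg hI₂0 hv0
    nlinarith
  have h2 : 0 ≤ e * ((I₁ + 4) * v + I₂ * u) := by positivity
  have h3 : 16 * C * (e * X) * u * 4 + 16 * C * (X * v) * I₂ + 16 * C * (e * X) * u * I₁ =
    16 * C * X * (e * (I₁ + 4) * u + I₂ * v) := by ring
  have h4 : 16 * C * e * (I₁ + 4 + I₂) * X * (u + v) = 16 * C * X * (e * (I₁ + 4) * u + e * I₂ * v +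
    e * ((I₁ + 4) * v + I₂ * u)) := by ring
  rw [h3, h4]
  apply mul_le_mul_of_nonneg_left _ hCX.le
  linarith

end ContourShift

/-! ### From Riesz means to sharp partial sums. -/

lemma norm_sum_Icc_floor_le {a : ℕ → ℂ} (ha : ∀ n, ‖a n‖ ≤ 1) {x : ℝ} (hx : 0 ≤ x) :
    ‖∑ n ∈ Finset.Icc 1 ⌊x⌋₊, a n‖ ≤ x := by
  calc _ ≤ ∑ n ∈ Finset.Icc 1 ⌊x⌋₊, (1 : ℝ) :=
        norm_sum_le_of_le _ fun n _ => ha n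
    _ = ⌊x⌋₊ := by simp
    _ ≤ x := Nat.floor_le hx

/-- With Y = x + h, the difference of ∑_{n ≤ Y} a(n)(Y - n) and ∑_{n ≤ x} a(n)(x - n) is h ∑_{n ≤ x}
a(n) plus at most h + 1 terms of size at most h. -/
lemma mul_norm_sum_le_of_riesz {a : ℕ → ℂ} (ha : ∀ n, ‖a n‖ ≤ 1) {x h : ℝ} (hx : 0 < x)
    (hh : 0 < h) :
    h * ‖∑ n ∈ Finset.Icc 1 ⌊x⌋₊, a n‖ ≤
      (x + h) * ‖∑ n ∈ Finset.Icc 1 ⌊x + h⌋₊, a n * (1 - n / ((x + h : ℝ) : ℂ))‖ +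
      x * ‖∑ n ∈ Finset.Icc 1 ⌊x⌋₊, a n * (1 - n / (x : ℂ))‖ + h * (h + 1) := by
  set Y := x + h with hY
  have hY0 : 0 < Y := by positivity
  have hmono : ⌊x⌋₊ ≤ ⌊Y⌋₊ := Nat.floor_mono (by linarith)
  have hscale : ∀ z : ℝ, 0 < z → ∀ m : ℕ, (z : ℂ) * ∑ n ∈ Finset.Ioc 0 m, a n * (1 - n / (z : ℂ)) =
      ∑ n ∈ Finset.Ioc 0 m, a n * (z - n) := by
    intro z hz m
    have : (z : ℂ) ≠ 0 := by exact_mod_cast hz.ne'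
    rw [Finset.mul_sum]
    refine Finset.sum_congr rfl fun n _ => ?_
    field_simp
  have hI : ∀ m, Finset.Icc 1 m = Finset.Ioc 0 m := fun m => rfl
  simp only [hI]
  have h1 : (h : ℂ) * ∑ n ∈ Finset.Ioc 0 ⌊x⌋₊, a n =
      Y * ∑ n ∈ Finset.Ioc 0 ⌊Y⌋₊, a n * (1 - n / (Y : ℂ)) -
      x * ∑ n ∈ Finset.Ioc 0 ⌊x⌋₊, a n * (1 - n / (x : ℂ)) -
      ∑ n ∈ Finset.Ioc ⌊x⌋₊ ⌊Y⌋₊, a n * (Y - n) := by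
    rw [hscale Y hY0, hscale x hx, ← Finset.sum_Ioc_consecutive _ (Nat.zero_le _) hmono,
      add_sub_right_comm, add_sub_cancel_right, ← Finset.sum_sub_distrib, Finset.mul_sum]
    refine Finset.sum_congr rfl fun n _ => ?_
    rw [hY]; push_cast; ring
  have h2 : ‖∑ n ∈ Finset.Ioc ⌊x⌋₊ ⌊Y⌋₊, a n * (Y - n)‖ ≤ h * (h + 1) := by
    have h3 : ∀ n ∈ Finset.Ioc ⌊x⌋₊ ⌊Y⌋₊, ‖a n * (Y - n)‖ ≤ h := by
      intro n hn
      obtain ⟨h4, h5⟩ := Finset.mem_Ioc.1 hn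
      have h6 : x < n := (Nat.floor_lt hx.le).1 h4
      have h7 : (n : ℝ) ≤ Y := (Nat.le_floor_iff hY0.le).1 h5
      have h8 : ‖(Y : ℂ) - n‖ = Y - n := by
        have : (Y : ℂ) - n = ((Y - n : ℝ) : ℂ) := by push_cast; rfl
        rw [this, Complex.norm_real, Real.norm_of_nonneg (by linarith)]
      rw [norm_mul, h8]
      have := ha n
      nlinarith [norm_nonneg (a n)]
    have h9 : ((⌊Y⌋₊ - ⌊x⌋₊ : ℕ) : ℝ) ≤ h + 1 := by
      rw [Nat.cast_sub hmono]
      linarith [Nat.floor_le hY0.le, Nat.lt_floor_add_one x]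
    refine (norm_sum_le_of_le _ h3).trans ?_
    rw [Finset.sum_const, Nat.card_Ioc, nsmul_eq_mul, mul_comm]
    gcongr
  have hn : ∀ z : ℝ, 0 < z → ∀ w : ℂ, ‖(z : ℂ) * w‖ = z * ‖w‖ := fun z hz w => by
    rw [norm_mul, Complex.norm_real, Real.norm_of_nonneg hz.le]
  rw [← hn h hh, h1, ← hn Y hY0, ← hn x hx]
  exact (norm_sub_le _ _).trans (add_le_add (norm_sub_le _ _) h2)

/-- Differencing with step h = xE, where E² is the saving in the Riesz means, leaves the saving E;
hence the 2c in the hypothesis and c in the conclusion. -/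
lemma exists_norm_sum_le_of_riesz {a : ℕ → ℂ} (ha : ∀ n, ‖a n‖ ≤ 1) {K c : ℝ} (hK : 0 < K)
    (hc : 0 < c) (hc1 : c ≤ 1)
    (hR : ∀ X : ℝ, Real.exp 1 ≤ X → ‖∑ n ∈ Finset.Icc 1 ⌊X⌋₊, a n * (1 - n / (X : ℂ))‖ ≤
      K * X * Real.exp (-(2 * c * √(Real.log X)))) :
    ∃ C : ℝ, 0 < C ∧ ∀ x : ℝ, 0 ≤ x →
      ‖∑ n ∈ Finset.Icc 1 ⌊x⌋₊, a n‖ ≤ C * x * Real.exp (-(c * √(Real.log x))) := by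
  refine ⟨5 * K + 2 + Real.exp 1, by positivity, fun x hx => ?_⟩
  set E := Real.exp (-(c * √(Real.log x))) with hE
  have hE0 : 0 < E := Real.exp_pos _
  have hE1 : E ≤ 1 := Real.exp_le_one_iff.2 (by
    have := mul_nonneg hc.le (Real.sqrt_nonneg (Real.log x)); linarith)
  rcases lt_or_ge x (Real.exp 1) with hxe | hxe
  · refine (norm_sum_Icc_floor_le ha hx).trans ?_
    have h1 : √(Real.log x) ≤ 1 := by
      rw [Real.sqrt_le_one]
      rcases hx.eq_or_lt with rfl | h
      · simp
      · exact (Real.log_le_iff_le_exp h).2 hxe.le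
    have h2 : Real.exp (-1) ≤ E := by
      apply Real.exp_le_exp.2
      nlinarith [Real.sqrt_nonneg (Real.log x)]
    have h3 : 1 ≤ Real.exp 1 * E := by
      calc (1 : ℝ) = Real.exp 1 * Real.exp (-1) := by rw [← Real.exp_add]; simp
        _ ≤ _ := by gcongr
    have h4 : 1 ≤ (5 * K + 2 + Real.exp 1) * E := by nlinarith
    nlinarith
  · have hx0 : 0 < x := (Real.exp_pos 1).trans_le hxe
    have hL1 : 1 ≤ Real.log x := by rwa [Real.le_log_iff_exp_le hx0]
    set h := x * E with hh
    have hh0 : 0 < h := by positivity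
    have hhx : h ≤ x := mul_le_of_le_one_right hx0.le hE1
    have hE2 : Real.exp (-(2 * c * √(Real.log x))) = E ^ 2 := by
      rw [hE, ← Real.exp_nat_mul]; congr 1; push_cast; ring
    have hEY : Real.exp (-(2 * c * √(Real.log (x + h)))) ≤ E ^ 2 := by
      rw [← hE2]
      gcongr
      linarith
    have hxE : 1 ≤ x * E := by
      rw [hE, ← Real.exp_log hx0, ← Real.exp_add, Real.log_exp]
      apply Real.one_le_exp
      have h1 : √(Real.log x) ≤ Real.log x := by
        rw [Real.sqrt_le_left (by linarith)]; nlinarith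
      have := Real.sqrt_nonneg (Real.log x)
      nlinarith
    have key := mul_norm_sum_le_of_riesz ha hx0 hh0
    have r1 := hR (x + h) (by linarith)
    have r2 := hR x hxe
    rw [hE2] at r2
    have r1' : ‖∑ n ∈ Finset.Icc 1 ⌊x + h⌋₊, a n * (1 - n / ((x + h : ℝ) : ℂ))‖ ≤
        K * (2 * x) * E ^ 2 := r1.trans (by gcongr; linarith)
    have h5 : h * ‖∑ n ∈ Finset.Icc 1 ⌊x⌋₊, a n‖ ≤ h * ((5 * K + 1) * (x * E) + 1) := by
      calc _ ≤ (2 * x) * (K * (2 * x) * E ^ 2) + x * (K * x * E ^ 2) + h * (h + 1) := by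
            refine key.trans ?_
            gcongr
            linarith
        _ = _ := by rw [hh]; ring
    have h6 := le_of_mul_le_mul_left h5 hh0
    refine h6.trans ?_
    have := Real.exp_pos 1
    nlinarith

/-! ### The prime number theorem for μχ. -/

namespace DirichletCharacter

variable {N : ℕ} [NeZero N] (χ : DirichletCharacter ℂ N)

/-- The prime number theorem with classical error term, for the Möbius function twisted by a
Dirichlet character. -/
theorem exists_norm_sum_mul_moebius_le :
    ∃ c C : ℝ, 0 < c ∧ 0 < C ∧ ∀ x : ℝ, 0 ≤ x →
      ‖∑ n ∈ Finset.Icc 1 ⌊x⌋₊, χ n * (ArithmeticFunction.moebius n : ℂ)‖ ≤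
        C * x * Real.exp (-(c * √(Real.log x))) := by
  obtain ⟨W, c₀, C₀, hc₀, hC₀, hW1, hW2⟩ := χ.exists_inv_LFunction_extension
  set c := min c₀ (1 / 2) with hc
  have hc0 : 0 < c := by positivity
  have hc2 : c ≤ 1 / 2 := min_le_right _ _
  obtain ⟨K, hK, hint⟩ := exists_norm_integral_le_of_region hc0 hc2 hC₀ (fun s h1 h2 => by
    refine hW2 s (le_trans ?_ h1) h2
    have := one_le_log_add_four (abs_nonneg s.im)
    have : c / Real.log (|s.im| + 4) ≤ c₀ / Real.log (|s.im| + 4) := by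
      gcongr; exact min_le_left _ _
    linarith)
  set d := c / 6 with hd
  have hd0 : 0 < d := by positivity
  obtain ⟨C, hC, hbound⟩ := exists_norm_sum_le_of_riesz χ.norm_mul_moebius_le_one
    (K := 2 * K) (c := d) (by positivity) hd0 (by linarith) (fun X hX => by
      have hX0 : 0 < X := (Real.exp_pos 1).trans_le hX
      have hL1 : 1 ≤ Real.log X := by rwa [Real.le_log_iff_exp_le hX0]
      set L := Real.log X with hL
      have hsq1 : 1 ≤ √L := by rw [Real.one_le_sqrt]; exact hL1
      have hσ : 1 < 1 + 1 / L := by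
        linarith [one_div_pos.2 (zero_lt_one.trans_le hL1)]
      have h1 := sum_mul_one_sub_div_eq_integral χ.norm_mul_moebius_le_one hσ hX0
      -- With T = exp(√L) both T^{-1/4} and exp(-cL / log T) have the shape exp(-const·√L). The rate
      -- d = c/6 comes from log(T + 4) ≤ 3√L, since c/3 = 2d.
      have h2 := hint X (Real.exp √L) hX (Real.exp_pos _)
      have h3 : ∀ y : ℝ, LSeries (fun n => χ n * (ArithmeticFunction.moebius n : ℂ))
          ((1 + 1 / L : ℝ) + y * Complex.I) = W ((1 + 1 / L : ℝ) + y * Complex.I) := by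
        intro y
        have h4 : 1 < (((1 + 1 / L : ℝ) : ℂ) + y * Complex.I).re := by
          have : (((1 + 1 / L : ℝ) : ℂ) + y * Complex.I).re = 1 + 1 / L := by simp
          rw [this]; exact hσ
        rw [hW1 _ h4, χ.LSeries_mul_moebius_eq_inv h4]
      simp only [h3] at h1
      rw [← h1, norm_mul] at h2
      have h5 : ‖(2 * Real.pi : ℂ)‖ = 2 * Real.pi := by
        simp [abs_of_pos Real.pi_pos]
      rw [h5] at h2
      have h6 : (1 : ℝ) ≤ 2 * Real.pi := by linarith [Real.pi_gt_three]
      have h7 : (1 + Real.exp √L) ^ (-(1 / 4) : ℝ) ≤ Real.exp (-(2 * d * √L)) := by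
        calc _ ≤ (Real.exp √L) ^ (-(1 / 4) : ℝ) :=
              Real.rpow_le_rpow_of_nonpos (Real.exp_pos _) (by linarith) (by norm_num)
          _ = Real.exp (√L * (-(1 / 4))) := (Real.exp_mul _ _).symm
          _ ≤ _ := by
            apply Real.exp_le_exp.2
            nlinarith
      have h8 : Real.log (Real.exp √L + 4) ≤ 3 * √L := by
        rw [Real.log_le_iff_le_exp (by positivity)]
        have h9 : Real.exp (3 * √L) = Real.exp √L ^ 3 := by
          rw [← Real.exp_nat_mul]; norm_num
        have h10 : 2 ≤ Real.exp √L := by linarith [Real.add_one_le_exp √L]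
        have h11 : (2.7 : ℝ) ≤ Real.exp √L := by
          have := Real.exp_le_exp.2 hsq1
          linarith [Real.exp_one_gt_d9]
        rw [h9]
        nlinarith [sq_nonneg (Real.exp √L)]
      have h12 : Real.exp (-(c * L / Real.log (Real.exp √L + 4))) ≤ Real.exp (-(2 * d * √L)) := by
        apply Real.exp_le_exp.2
        have h13 := one_le_log_add_four (Real.exp_pos √L).le
        have h14 : c * L / (3 * √L) ≤ c * L / Real.log (Real.exp √L + 4) := by gcongr
        have h15 : c * L / (3 * √L) = 2 * d * √L := by
          nth_rewrite 1 [← Real.mul_self_sqrt (by linarith : 0 ≤ L)]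
          rw [hd]; field_simp; ring
        linarith
      calc _ ≤ 2 * Real.pi * ‖∑ n ∈ Finset.Icc 1 ⌊X⌋₊,
            χ n * (ArithmeticFunction.moebius n : ℂ) * (1 - n / (X : ℂ))‖ :=
            le_mul_of_one_le_left (norm_nonneg _) h6
        _ ≤ _ := h2
        _ ≤ K * X * (Real.exp (-(2 * d * √L)) + Real.exp (-(2 * d * √L))) := by gcongr
        _ = _ := by ring)
  exact ⟨d, C, hd0, hC, hbound⟩

end DirichletCharacter

/-! ### The modified character and its logarithmic partial sums. -/

section ModifiedCharacter

lemma sum_Icc_filter_dvd {M : Type*} [AddCommMonoid M] (F : ℕ → M) {D : ℕ} (hD : 0 < D) (X : ℕ) :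
    ∑ n ∈ Finset.Icc 1 X with D ∣ n, F n = ∑ m ∈ Finset.Icc 1 (X / D), F (D * m) := by
  refine (Finset.sum_nbij' (fun m => D * m) (fun n => n / D) ?_ ?_ ?_ ?_ ?_).symm
  · intro m hm
    obtain ⟨h1, h2⟩ := Finset.mem_Icc.1 hm
    refine Finset.mem_filter.2 ⟨Finset.mem_Icc.2 ⟨Nat.mul_pos hD h1, ?_⟩, dvd_mul_right _ _⟩
    rw [mul_comm]
    exact (Nat.le_div_iff_mul_le hD).1 h2
  · intro n hn
    obtain ⟨h1, h2⟩ := Finset.mem_filter.1 hn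
    obtain ⟨h3, h4⟩ := Finset.mem_Icc.1 h1
    exact Finset.mem_Icc.2 ⟨Nat.div_pos (Nat.le_of_dvd h3 h2) hD, Nat.div_le_div_right h4⟩
  · intro m _
    exact Nat.mul_div_cancel_left m hD
  · intro n hn
    exact Nat.mul_div_cancel' (Finset.mem_filter.1 hn).2
  · intro _ _
    rfl

/-- The completely multiplicative function that agrees with `ZMod.χ₄` on odd integers and takes the
value `1` at `2`. -/
def chiFourMod (n : ℕ) : ℤ := ZMod.χ₄ ((n / 2 ^ n.factorization 2 : ℕ) : ZMod 4)

lemma chiFourMod_mul (m n : ℕ) : chiFourMod (m * n) = chiFourMod m * chiFourMod n := by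
  rw [chiFourMod, Nat.ordCompl_mul, Nat.cast_mul, map_mul, chiFourMod, chiFourMod]

lemma chiFourMod_of_odd {n : ℕ} (hn : ¬ 2 ∣ n) : chiFourMod n = ZMod.χ₄ n := by
  rw [chiFourMod, (Nat.ordCompl_eq_self_iff_zero_or_not_dvd n Nat.prime_two).2 (Or.inr hn)]

lemma chiFourMod_one : chiFourMod 1 = 1 := by
  rw [chiFourMod_of_odd (by norm_num)]; simp

lemma chiFourMod_two_mul (n : ℕ) : chiFourMod (2 * n) = chiFourMod n := by
  have := Nat.ordCompl_self_pow_mul n 1 Nat.prime_two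
  rw [pow_one] at this
  rw [chiFourMod, this, chiFourMod]

lemma chiFourMod_pow (n k : ℕ) : chiFourMod (n ^ k) = chiFourMod n ^ k := by
  induction k with
  | zero => simp [chiFourMod_one]
  | succ k ih => rw [pow_succ, chiFourMod_mul, ih, pow_succ]

lemma chiFourMod_eq_one_or {n : ℕ} (hn : n ≠ 0) : chiFourMod n = 1 ∨ chiFourMod n = -1 := by
  have h := Nat.not_dvd_ordCompl Nat.prime_two hn
  rw [chiFourMod, ZMod.χ₄_nat_eq_if_mod_four]
  rw [Nat.dvd_iff_mod_eq_zero] at h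
  rw [if_neg h]
  split_ifs <;> simp

lemma chiFourMod_zero : chiFourMod 0 = 0 := by
  simp [chiFourMod]

lemma abs_chiFourMod_le_one (n : ℕ) : |chiFourMod n| ≤ 1 := by
  rcases eq_or_ne n 0 with rfl | hn
  · simp [chiFourMod_zero]
  · rcases chiFourMod_eq_one_or hn with h | h <;> simp [h]

lemma sum_chi_four_eq (m : ℕ) :
    ∑ n ∈ Finset.Icc 1 m, ZMod.χ₄ n = if m % 4 = 1 ∨ m % 4 = 2 then 1 else 0 := by
  induction m with
  | zero => simp
  | succ m ih =>
    rw [Finset.sum_Icc_succ_top (by lia), ih, ZMod.χ₄_nat_eq_if_mod_four]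
    split_ifs <;> lia

/-- χ₄ accounts for the odd n; the even n reproduce the sum at half the length. -/
lemma sum_chiFourMod_eq (m : ℕ) :
    ∑ n ∈ Finset.Icc 1 m, chiFourMod n =
      ∑ n ∈ Finset.Icc 1 m, ZMod.χ₄ n + ∑ n ∈ Finset.Icc 1 (m / 2), chiFourMod n := by
  have h1 : ∑ n ∈ Finset.Icc 1 (m / 2), chiFourMod n =
      ∑ n ∈ Finset.Icc 1 m with 2 ∣ n, chiFourMod n := by
    rw [sum_Icc_filter_dvd _ two_pos]
    simp only [chiFourMod_two_mul]
  rw [h1, Finset.sum_filter, ← Finset.sum_add_distrib]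
  refine Finset.sum_congr rfl fun n _ => ?_
  by_cases h : 2 ∣ n
  · rw [if_pos h, ZMod.χ₄_nat_eq_if_mod_four, if_pos (Nat.mod_eq_zero_of_dvd h), zero_add]
  · rw [if_neg h, chiFourMod_of_odd h, add_zero]

/-- Each halving contributes a partial sum of χ₄, which is 0 or 1. -/
lemma abs_sum_chiFourMod_le (m : ℕ) :
    |∑ n ∈ Finset.Icc 1 m, chiFourMod n| ≤ Nat.log 2 m + 1 := by
  induction m using Nat.strong_induction_on with
  | _ m ih =>
    have h0 : |∑ n ∈ Finset.Icc 1 m, ZMod.χ₄ n| ≤ 1 := by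
      rw [sum_chi_four_eq]; split_ifs <;> simp
    rw [sum_chiFourMod_eq]
    rcases lt_or_ge m 2 with h | h
    · have : m / 2 = 0 := by lia
      rw [this]
      simp only [Finset.Icc_eq_empty_of_lt zero_lt_one, Finset.sum_empty, add_zero]
      refine h0.trans ?_
      have : (0 : ℤ) ≤ Nat.log 2 m := Int.natCast_nonneg _
      linarith
    · refine (abs_add_le _ _).trans ?_
      have h1 := ih (m / 2) (by lia)
      rw [Nat.log_of_one_lt_of_le one_lt_two h]
      push_cast
      linarith

end ModifiedCharacter

/-! ### Restriction to k-free integers. -/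

section KFree

/-- Since d^k ∣ n exactly when d ∣ `Nat.floorRoot k n`, sums over k-th power divisors become
ordinary divisor sums. -/
lemma isKFree_iff_floorRoot_eq_one {k n : ℕ} :
    IsKFree k n ↔ Nat.floorRoot k n = 1 := by
  rw [IsKFree, Nat.eq_one_iff_not_exists_prime_dvd]
  simp only [Nat.pow_dvd_iff_dvd_floorRoot]

lemma not_isKFree_zero (k : ℕ) : ¬ IsKFree k 0 := fun h => h 2 Nat.prime_two (dvd_zero _)

lemma isKFree_of_squarefree {k n : ℕ} (hk : 2 ≤ k) (hn : Squarefree n) : IsKFree k n := by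
  intro p hp h
  have h1 : p * p ∣ n := by
    rw [← pow_two]; exact (pow_dvd_pow p hk).trans h
  exact hp.one_lt.ne' (Nat.isUnit_iff.1 (hn p h1))

lemma isKFree_mul_iff {k m n : ℕ} (hk : k ≠ 0) (hmn : m.Coprime n) :
    IsKFree k (m * n) ↔ IsKFree k m ∧ IsKFree k n := by
  simp only [IsKFree]
  rw [← forall₂_and]
  refine forall₂_congr fun p hp => ?_
  rw [hmn.isPrimePow_dvd_mul (hp.isPrimePow.pow hk), not_or]

/-- The indicator of the `k`-free integers as a sum over the `k`-th power divisors. -/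
lemma sum_moebius_filter_pow_dvd {k n X : ℕ} (hk : k ≠ 0) (hn : n ≠ 0) (hX : n ≤ X)
    [Decidable (IsKFree k n)] :
    ∑ d ∈ Finset.Icc 1 X with d ^ k ∣ n, ArithmeticFunction.moebius d =
      if IsKFree k n then 1 else 0 := by
  have h0 : Nat.floorRoot k n ≠ 0 := Nat.floorRoot_ne_zero.2 ⟨hk, hn⟩
  have h1 : Finset.filter (fun d => d ^ k ∣ n) (Finset.Icc 1 X) = (Nat.floorRoot k n).divisors := by
    ext d
    simp only [Finset.mem_filter, Finset.mem_Icc, Nat.mem_divisors, Nat.pow_dvd_iff_dvd_floorRoot]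
    refine ⟨fun h => ⟨h.2, h0⟩, fun h => ⟨⟨Nat.pos_of_dvd_of_pos h.1 (Nat.pos_of_ne_zero h0), ?_⟩,
      h.1⟩⟩
    have h2 : d ^ k ∣ n := Nat.pow_dvd_iff_dvd_floorRoot.2 h.1
    exact (Nat.le_self_pow hk d).trans ((Nat.le_of_dvd (Nat.pos_of_ne_zero hn) h2).trans hX)
  have h2 : ∑ d ∈ (Nat.floorRoot k n).divisors, ArithmeticFunction.moebius d =
      (ArithmeticFunction.moebius * (ArithmeticFunction.zeta : ArithmeticFunction ℤ))
        (Nat.floorRoot k n) := ArithmeticFunction.coe_mul_zeta_apply.symm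
  rw [h1, h2, ArithmeticFunction.moebius_mul_coe_zeta, ArithmeticFunction.one_apply]
  simp only [isKFree_iff_floorRoot_eq_one]

open scoped Classical in
/-- The restriction of `chiFourMod` to the `k`-free integers. -/
noncomputable def chiFourModKFree (k : ℕ) : ArithmeticFunction ℤ where
  toFun n := if IsKFree k n then chiFourMod n else 0
  map_zero' := if_neg (not_isKFree_zero k)

open scoped Classical in
lemma chiFourModKFree_apply (k n : ℕ) :
    chiFourModKFree k n = if IsKFree k n then chiFourMod n else 0 := rfl

lemma isMultiplicative_chiFourModKFree {k : ℕ} (hk : 2 ≤ k) :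
    (chiFourModKFree k).IsMultiplicative := by
  refine ⟨?_, fun {m n} hmn => ?_⟩
  · rw [chiFourModKFree_apply, if_pos (isKFree_of_squarefree hk squarefree_one), chiFourMod_one]
  · have h := isKFree_mul_iff (by lia : k ≠ 0) hmn
    by_cases h1 : IsKFree k m <;> by_cases h2 : IsKFree k n <;>
      simp [chiFourModKFree_apply, chiFourMod_mul, h, h1, h2]

lemma chiFourModKFree_eq (k n : ℕ) :
    chiFourModKFree k n = -1 ∨ chiFourModKFree k n = 0 ∨ chiFourModKFree k n = 1 := by
  rw [chiFourModKFree_apply]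
  split_ifs with h
  · have hn : n ≠ 0 := by rintro rfl; exact not_isKFree_zero k h
    rcases chiFourMod_eq_one_or hn with h | h <;> simp [h]
  · simp

/-- Detect k-free n by μ, write n = d^k m, and use complete multiplicativity. -/
lemma sum_chiFourModKFree {k : ℕ} (hk : k ≠ 0) (X : ℕ) :
    ∑ n ∈ Finset.Icc 1 X, chiFourModKFree k n =
      ∑ d ∈ Finset.Icc 1 X, ArithmeticFunction.moebius d * chiFourMod d ^ k *
        ∑ m ∈ Finset.Icc 1 (X / d ^ k), chiFourMod m := by
  classical
  have h1 : ∀ n ∈ Finset.Icc 1 X, chiFourModKFree k n =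
      ∑ d ∈ Finset.Icc 1 X, if d ^ k ∣ n then ArithmeticFunction.moebius d * chiFourMod n
        else 0 := by
    intro n hn
    obtain ⟨h1, h2⟩ := Finset.mem_Icc.1 hn
    rw [← Finset.sum_filter, ← Finset.sum_mul, sum_moebius_filter_pow_dvd hk (by lia) h2,
      chiFourModKFree_apply]
    split_ifs <;> simp
  rw [Finset.sum_congr rfl h1, Finset.sum_comm]
  refine Finset.sum_congr rfl fun d hd => ?_
  have hd0 : 0 < d ^ k := pow_pos (Finset.mem_Icc.1 hd).1 k
  rw [← Finset.sum_filter, sum_Icc_filter_dvd _ hd0, Finset.mul_sum]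
  refine Finset.sum_congr rfl fun m _ => ?_
  rw [chiFourMod_mul, chiFourMod_pow]
  ring

end KFree

/-! ### The hyperbola method. -/

section Hyperbola

/-- A form of the Dirichlet hyperbola method. -/
lemma abs_sum_mul_sum_le {g h : ℕ → ℝ} (hg : ∀ n, |g n| ≤ 1) (hh : ∀ n, |h n| ≤ 1)
    {k X D Y : ℕ} (hk : k ≠ 0) (hXY : X < (D + 1) ^ k * (Y + 1)) {A B : ℝ}
    (hA0 : 0 ≤ A) (hB0 : 0 ≤ B)
    (hA : ∀ n ≤ X, |∑ m ∈ Finset.Icc 1 n, g m| ≤ A)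
    (hB : ∀ r, D ≤ r → r ^ k ≤ X → |∑ d ∈ Finset.Icc 1 r, h d| ≤ B) :
    |∑ d ∈ Finset.Icc 1 X, h d * ∑ m ∈ Finset.Icc 1 (X / d ^ k), g m| ≤ D * A + Y * (2 * B) := by
  rw [← Finset.sum_filter_add_sum_filter_not _ (fun d => d ≤ D)]
  refine (abs_add_le _ _).trans (add_le_add ?_ ?_)
  · calc _ ≤ ∑ d ∈ Finset.Icc 1 X with d ≤ D, A := by
          refine (Finset.abs_sum_le_sum_abs _ _).trans (Finset.sum_le_sum fun d _ => ?_)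
          rw [abs_mul]
          have h1 := hA (X / d ^ k) (Nat.div_le_self _ _)
          have h2 := hh d
          nlinarith [abs_nonneg (h d), abs_nonneg (∑ m ∈ Finset.Icc 1 (X / d ^ k), g m)]
      _ = (Finset.card (Finset.filter (fun d => d ≤ D) (Finset.Icc 1 X)) : ℝ) * A := by
          rw [Finset.sum_const, nsmul_eq_mul]
      _ ≤ D * A := by
          have h1 : Finset.filter (fun d => d ≤ D) (Finset.Icc 1 X) ⊆ Finset.Icc 1 D := by
            intro d hd
            simp only [Finset.mem_filter, Finset.mem_Icc] at hd ⊢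
            exact ⟨hd.1.1, hd.2⟩
          have h2 := Finset.card_le_card h1
          rw [Nat.card_Icc, Nat.add_sub_cancel] at h2
          gcongr
  · have hswap : ∑ d ∈ Finset.Icc 1 X with ¬ d ≤ D, h d * ∑ m ∈ Finset.Icc 1 (X / d ^ k), g m =
        ∑ m ∈ Finset.Icc 1 Y, g m *
          ∑ d ∈ Finset.Icc 1 X with (D < d ∧ d ^ k * m ≤ X), h d := by
      simp only [Finset.mul_sum]
      rw [Finset.sum_comm' (t' := Finset.Icc 1 Y)
        (s' := fun m => Finset.filter (fun d => D < d ∧ d ^ k * m ≤ X) (Finset.Icc 1 X))]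
      · simp only [mul_comm]
      · intro d m
        simp only [Finset.mem_filter, Finset.mem_Icc, not_le]
        constructor
        · rintro ⟨⟨⟨h1, h2⟩, h3⟩, h4, h5⟩
          have hd0 : 0 < d ^ k := pow_pos h1 k
          have h6 : d ^ k * m ≤ X := by
            rw [mul_comm]; exact (Nat.le_div_iff_mul_le hd0).1 h5
          refine ⟨⟨⟨h1, h2⟩, h3, h6⟩, h4, ?_⟩
          by_contra h7
          have h8 : (D + 1) ^ k * (Y + 1) ≤ d ^ k * m :=
            Nat.mul_le_mul (Nat.pow_le_pow_left h3 k) (by lia)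
          lia
        · rintro ⟨⟨⟨h1, h2⟩, h3, h6⟩, h4, _⟩
          have hd0 : 0 < d ^ k := pow_pos h1 k
          exact ⟨⟨⟨h1, h2⟩, h3⟩, h4, (Nat.le_div_iff_mul_le hd0).2 (by rwa [mul_comm])⟩
    rw [hswap]
    have hinner : ∀ m ∈ Finset.Icc 1 Y,
        |g m * ∑ d ∈ Finset.Icc 1 X with (D < d ∧ d ^ k * m ≤ X), h d| ≤ 2 * B := by
      intro m hm
      have hm1 : 1 ≤ m := (Finset.mem_Icc.1 hm).1
      -- The admissible d fill the interval (D, r], so the inner sum is a difference of two partial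
      -- sums of h, each at most B; it is empty when r < D.
      set r := Nat.findGreatest (fun d => d ^ k * m ≤ X) X with hr
      have hrX : r ^ k * m ≤ X :=
        Nat.findGreatest_spec (P := fun d => d ^ k * m ≤ X) (Nat.zero_le X) (by simp [hk])
      have hrk : r ^ k ≤ X := (Nat.le_mul_of_pos_right _ hm1).trans hrX
      have hset : Finset.filter (fun d => D < d ∧ d ^ k * m ≤ X) (Finset.Icc 1 X) =
          Finset.Ioc D r := by
        ext d
        simp only [Finset.mem_filter, Finset.mem_Icc, Finset.mem_Ioc]
        constructor
        · rintro ⟨⟨_, h2⟩, h3, h4⟩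
          exact ⟨h3, Nat.le_findGreatest h2 h4⟩
        · rintro ⟨h1, h2⟩
          refine ⟨⟨by lia, h2.trans (Nat.findGreatest_le X)⟩, h1, ?_⟩
          exact (Nat.mul_le_mul_right m (Nat.pow_le_pow_left h2 k)).trans hrX
      have hsum : |∑ d ∈ Finset.Ioc D r, h d| ≤ 2 * B := by
        rcases lt_or_ge r D with h1 | h1
        · rw [Finset.Ioc_eq_empty_of_le h1.le]
          simpa using hB0
        · have h2 := Finset.sum_Ioc_consecutive h (Nat.zero_le D) h1
          have h3 := hB r h1 hrk
          have h4 := hB D le_rfl ((Nat.pow_le_pow_left h1 k).trans hrk)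
          have hI : ∀ m, Finset.Icc 1 m = Finset.Ioc 0 m := fun m => rfl
          rw [hI] at h3 h4
          rw [abs_le] at h3 h4 ⊢
          constructor <;> linarith [h3.1, h3.2, h4.1, h4.2]
      rw [hset, abs_mul]
      have := hg m
      nlinarith [abs_nonneg (g m), abs_nonneg (∑ d ∈ Finset.Ioc D r, h d)]
    calc _ ≤ ∑ m ∈ Finset.Icc 1 Y, 2 * B :=
          (Finset.abs_sum_le_sum_abs _ _).trans (Finset.sum_le_sum hinner)
      _ = Y * (2 * B) := by simp

end Hyperbola

/-! ### Cancellation in Möbius sums twisted by powers of the modified character. -/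

lemma moebius_two_mul (m : ℕ) : ArithmeticFunction.moebius (2 * m) =
    if 2 ∣ m then 0 else -ArithmeticFunction.moebius m := by
  split_ifs with h
  · apply ArithmeticFunction.moebius_eq_zero_of_not_squarefree
    intro hs
    have := hs 2 (Nat.mul_dvd_mul_left 2 h)
    norm_num at this
  · have hc : Nat.Coprime 2 m := (Nat.Prime.coprime_iff_not_dvd Nat.prime_two).2 h
    rw [ArithmeticFunction.isMultiplicative_moebius.map_mul_of_coprime hc,
      ArithmeticFunction.moebius_apply_prime Nat.prime_two, neg_one_mul]

/-- The powers of `ZMod.χ₄` as Dirichlet characters. -/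
noncomputable def chiFourPow (k : ℕ) : DirichletCharacter ℂ 4 :=
  (ZMod.χ₄.ringHomComp (Int.castRingHom ℂ)) ^ k

lemma chiFourPow_apply {k : ℕ} (hk : k ≠ 0) (n : ℕ) :
    chiFourPow k n = ((ZMod.χ₄ n : ℤ) : ℂ) ^ k := by
  rw [chiFourPow, MulChar.pow_apply' _ hk]
  rfl

lemma chi_four_of_two_dvd {n : ℕ} (h : 2 ∣ n) : ZMod.χ₄ n = 0 := by
  rw [ZMod.χ₄_nat_eq_if_mod_four, if_pos (Nat.mod_eq_zero_of_dvd h)]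

/-- Changing the value at 2 from 0 to 1 multiplies the Dirichlet series 1/L(s, χ₄^k) by 1 - 2^{-s}.
-/
lemma sum_moebius_mul_chiFourMod_pow {k : ℕ} (hk : k ≠ 0) (r : ℕ) :
    (((∑ d ∈ Finset.Icc 1 r, ArithmeticFunction.moebius d * chiFourMod d ^ k : ℤ)) : ℂ) =
      ∑ d ∈ Finset.Icc 1 r, chiFourPow k d * (ArithmeticFunction.moebius d : ℂ) -
      ∑ d ∈ Finset.Icc 1 (r / 2), chiFourPow k d * (ArithmeticFunction.moebius d : ℂ) := by
  have h1 : ∑ d ∈ Finset.Icc 1 (r / 2), chiFourPow k d * (ArithmeticFunction.moebius d : ℂ) =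
      ∑ n ∈ Finset.Icc 1 r with 2 ∣ n,
        chiFourPow k (n / 2 : ℕ) * (ArithmeticFunction.moebius (n / 2) : ℂ) := by
    rw [sum_Icc_filter_dvd _ two_pos]
    simp only [Nat.mul_div_cancel_left _ two_pos]
  rw [h1, Finset.sum_filter, ← Finset.sum_sub_distrib, Int.cast_sum]
  refine Finset.sum_congr rfl fun n _ => ?_
  by_cases h : 2 ∣ n
  · obtain ⟨m, rfl⟩ := h
    rw [if_pos (dvd_mul_right 2 m), Nat.mul_div_cancel_left _ two_pos, chiFourMod_two_mul,
      moebius_two_mul, chiFourPow_apply hk, chiFourPow_apply hk,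
      chi_four_of_two_dvd (dvd_mul_right 2 m)]
    by_cases hm : 2 ∣ m
    · rw [if_pos hm, chi_four_of_two_dvd hm]
      simp [hk]
    · rw [if_neg hm, chiFourMod_of_odd hm]
      push_cast
      rw [zero_pow hk]
      ring
  · rw [if_neg h, chiFourMod_of_odd h, chiFourPow_apply hk]
    push_cast
    ring

/-- The sum of length r/2 has the weaker saving, which governs the bound. For r ≤ 1 the convention
`Real.log 0 = 0` makes the exponential 1. -/
lemma exists_abs_sum_moebius_mul_chiFourMod_pow_le {k : ℕ} (hk : k ≠ 0) :
    ∃ c C : ℝ, 0 < c ∧ 0 < C ∧ ∀ r : ℕ,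
      |∑ d ∈ Finset.Icc 1 r, ((ArithmeticFunction.moebius d * chiFourMod d ^ k : ℤ) : ℝ)| ≤
        C * r * Real.exp (-(c * √(Real.log (r / 2 : ℕ)))) := by
  obtain ⟨c, C, hc, hC, h⟩ := (chiFourPow k).exists_norm_sum_mul_moebius_le
  refine ⟨c, 2 * C, hc, by positivity, fun r => ?_⟩
  have h1 : |∑ d ∈ Finset.Icc 1 r, ((ArithmeticFunction.moebius d * chiFourMod d ^ k : ℤ) : ℝ)| =
      ‖(((∑ d ∈ Finset.Icc 1 r, ArithmeticFunction.moebius d * chiFourMod d ^ k : ℤ)) : ℂ)‖ := by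
    rw [Complex.norm_intCast, Int.cast_sum]
  rw [h1, sum_moebius_mul_chiFourMod_pow hk]
  have h2 := h r (Nat.cast_nonneg r)
  have h3 := h (r / 2 : ℕ) (Nat.cast_nonneg _)
  rw [Nat.floor_natCast] at h2 h3
  have h4 : ((r / 2 : ℕ) : ℝ) ≤ r := by exact_mod_cast Nat.div_le_self r 2
  have h5 : Real.log (r / 2 : ℕ) ≤ Real.log r := by
    rcases Nat.eq_zero_or_pos (r / 2) with h6 | h6
    · rw [h6, Nat.cast_zero, Real.log_zero]
      exact Real.log_natCast_nonneg r
    · exact Real.log_le_log (by exact_mod_cast h6) h4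
  set E := Real.exp (-(c * √(Real.log (r / 2 : ℕ)))) with hE
  have h6 : Real.exp (-(c * √(Real.log r))) ≤ E := by
    rw [hE]; gcongr
  calc _ ≤ C * r * Real.exp (-(c * √(Real.log r))) + C * (r / 2 : ℕ) * E :=
        (norm_sub_le _ _).trans (add_le_add h2 h3)
    _ ≤ C * r * E + C * r * E := by gcongr
    _ = _ := by ring

/-! ### Choice of parameters and conclusion. -/

lemma abs_sum_chiFourMod_le_log {X n : ℕ} (hn : n ≤ X) {x : ℝ} (hx : 1 ≤ x) (hX : (X : ℝ) ≤ x) :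
    |∑ m ∈ Finset.Icc 1 n, (chiFourMod m : ℝ)| ≤ 2 * Real.log x + 1 := by
  have h1 : |∑ m ∈ Finset.Icc 1 n, (chiFourMod m : ℝ)| ≤ (Nat.log 2 n : ℝ) + 1 := by
    exact_mod_cast abs_sum_chiFourMod_le n
  have h2 : (Nat.log 2 n : ℝ) ≤ 2 * Real.log x := by
    rcases Nat.eq_zero_or_pos n with rfl | hn0
    · simpa using Real.log_nonneg hx
    · have h3 := Real.natLog_le_logb n 2
      have h4 : Real.log n ≤ Real.log x :=
        Real.log_le_log (by exact_mod_cast hn0) (le_trans (by exact_mod_cast hn) hX)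
      have h5 : 0 ≤ Real.log n := Real.log_natCast_nonneg n
      rw [Real.logb] at h3
      refine h3.trans ?_
      push_cast
      rw [div_le_iff₀ (Real.log_pos one_lt_two)]
      nlinarith [Real.log_two_gt_d9]
  linarith

/-- With z = x^{1/k} and w = e^l, the cuts are D = ⌊z/w⌋ and Y = ⌊w^k⌋. The lower bounds on l make
log(D/2) comparable to log x and let c l²/(2k) exceed (k + 1)l. -/
lemma abs_sum_chiFourModKFree_le {k : ℕ} (hk : 2 ≤ k) {c C : ℝ} (hc : 0 < c) (hC : 0 < C)
    (hH : ∀ r : ℕ,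
      |∑ d ∈ Finset.Icc 1 r, ((ArithmeticFunction.moebius d * chiFourMod d ^ k : ℤ) : ℝ)| ≤
        C * r * Real.exp (-(c * √(Real.log (r / 2 : ℕ)))))
    {l : ℝ} (hl1 : 1 ≤ l) (hl2 : 6 * k ≤ l) (hl3 : 2 * k * (k + 1) / c ≤ l) {x : ℝ}
    (hx : x = Real.exp (l ^ 4)) :
    |∑ n ∈ Finset.Icc 1 ⌊x⌋₊, (chiFourModKFree k n : ℝ)| ≤
      (769 + 2 * C) * (Real.exp (l ^ 4 / k) * Real.exp (-(l / 2))) := by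
  have hk0 : k ≠ 0 := by lia
  have hkr : (0 : ℝ) < k := by exact_mod_cast Nat.pos_of_ne_zero hk0
  have hk1 : (1 : ℝ) ≤ k := by exact_mod_cast Nat.one_le_iff_ne_zero.2 hk0
  have hl0 : 0 < l := by linarith
  have hx0 : 0 < x := by rw [hx]; exact Real.exp_pos _
  have hx1 : 1 ≤ x := by rw [hx]; exact Real.one_le_exp (by positivity)
  have hlogx : Real.log x = l ^ 4 := by rw [hx, Real.log_exp]
  set z := Real.exp (l ^ 4 / k) with hz
  set w := Real.exp l with hw
  have hz0 : 0 < z := Real.exp_pos _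
  have hw0 : 0 < w := Real.exp_pos _
  have hzk : z ^ k = x := by
    rw [hz, ← Real.exp_nat_mul, hx]; congr 1; field_simp
  set X := ⌊x⌋₊ with hX
  have hXx : (X : ℝ) ≤ x := Nat.floor_le hx0.le
  set D := ⌊z / w⌋₊ with hD
  set Y := ⌊w ^ k⌋₊ with hY
  have hDle : (D : ℝ) ≤ z / w := Nat.floor_le (by positivity)
  have hDlt : z / w < D + 1 := Nat.lt_floor_add_one _
  have hYle : (Y : ℝ) ≤ w ^ k := Nat.floor_le (by positivity)
  have hYlt : w ^ k < Y + 1 := Nat.lt_floor_add_one _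
  have hXY : X < (D + 1) ^ k * (Y + 1) := by
    have h1 : (X : ℝ) < ((D : ℝ) + 1) ^ k * (Y + 1) := by
      calc (X : ℝ) ≤ (z / w) ^ k * w ^ k := by
            rw [← mul_pow, div_mul_cancel₀ _ hw0.ne', hzk]; exact hXx
        _ < (z / w) ^ k * (Y + 1) := by gcongr
        _ ≤ _ := by gcongr
    exact_mod_cast h1
  -- From l ≥ 1 and l ≥ 6k: 2k(l + 2) ≤ 6kl ≤ l² ≤ l⁴.
  have hl4 : l + 2 ≤ l ^ 4 / (2 * k) := by
    rw [le_div_iff₀ (by positivity)]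
    have h1 : l ^ 2 ≤ l ^ 4 := pow_le_pow_right₀ hl1 (by norm_num)
    nlinarith
  have hsplit : l ^ 4 / k = l ^ 4 / (2 * k) + l ^ 4 / (2 * k) := by field_simp; ring
  have hlogD : l ^ 4 / (2 * k) ≤ Real.log (D / 2 : ℕ) := by
    have h4 : (4 : ℝ) ≤ Real.exp 2 := by
      have h5 : Real.exp 2 = Real.exp 1 ^ 2 := by rw [← Real.exp_nat_mul]; norm_num
      rw [h5]
      nlinarith [Real.exp_one_gt_d9]
    have h1 : 4 * Real.exp (l ^ 4 / (2 * k)) ≤ z / w := by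
      rw [hz, hw, ← Real.exp_sub]
      calc _ ≤ Real.exp 2 * Real.exp (l ^ 4 / (2 * k)) := by gcongr
        _ = Real.exp (2 + l ^ 4 / (2 * k)) := (Real.exp_add _ _).symm
        _ ≤ _ := by apply Real.exp_le_exp.2; linarith
    have h2 : (1 : ℝ) ≤ Real.exp (l ^ 4 / (2 * k)) := Real.one_le_exp (by positivity)
    have h3 : (D : ℝ) ≤ 2 * (D / 2 : ℕ) + 1 := by
      have : D ≤ 2 * (D / 2) + 1 := by lia
      exact_mod_cast this
    have h5 : Real.exp (l ^ 4 / (2 * k)) ≤ (D / 2 : ℕ) := by linarith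
    rw [Real.le_log_iff_exp_le (by linarith)]
    exact h5
  have hsq : l ^ 2 / (2 * k) ≤ √(Real.log (D / 2 : ℕ)) := by
    apply Real.le_sqrt_of_sq_le
    refine le_trans ?_ hlogD
    rw [div_pow, div_le_div_iff₀ (by positivity) (by positivity)]
    have : 0 ≤ l ^ 4 * (2 * k) := by positivity
    nlinarith
  set B := C * z * Real.exp (-(c * (l ^ 2 / (2 * k)))) with hB
  have hBr : ∀ r : ℕ, D ≤ r → r ^ k ≤ X →
      |∑ d ∈ Finset.Icc 1 r, ((ArithmeticFunction.moebius d * chiFourMod d ^ k : ℤ) : ℝ)| ≤ B := by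
    intro r hr1 hr2
    refine (hH r).trans ?_
    have h1 : (r : ℝ) ≤ z := by
      refine le_of_pow_le_pow_left₀ hk0 hz0.le ?_
      rw [hzk]
      exact le_trans (by exact_mod_cast hr2) hXx
    have h2 : Real.log (D / 2 : ℕ) ≤ Real.log (r / 2 : ℕ) := by
      have h3 : D / 2 ≤ r / 2 := Nat.div_le_div_right hr1
      rcases Nat.eq_zero_or_pos (D / 2) with h4 | h4
      · rw [h4, Nat.cast_zero, Real.log_zero]
        exact Real.log_natCast_nonneg _
      · exact Real.log_le_log (by exact_mod_cast h4) (by exact_mod_cast h3)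
    have h3 : l ^ 2 / (2 * k) ≤ √(Real.log (r / 2 : ℕ)) := hsq.trans (Real.sqrt_le_sqrt h2)
    rw [hB]
    gcongr
  have hh1 : ∀ n, |((ArithmeticFunction.moebius n * chiFourMod n ^ k : ℤ) : ℝ)| ≤ 1 := by
    intro n
    have h1 : |ArithmeticFunction.moebius n * chiFourMod n ^ k| ≤ 1 := by
      rw [abs_mul, abs_pow]
      exact mul_le_one₀ ArithmeticFunction.abs_moebius_le_one (by positivity)
        (pow_le_one₀ (abs_nonneg _) (abs_chiFourMod_le_one n))
    exact_mod_cast h1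
  have hg1 : ∀ n, |(chiFourMod n : ℝ)| ≤ 1 := fun n => by exact_mod_cast abs_chiFourMod_le_one n
  have key := abs_sum_mul_sum_le (A := 2 * l ^ 4 + 1) hg1 hh1 hk0 hXY (by positivity)
    (by positivity : 0 ≤ B)
    (fun n hn => by rw [← hlogx]; exact abs_sum_chiFourMod_le_log hn hx1 hXx) hBr
  have hident : ∑ n ∈ Finset.Icc 1 X, (chiFourModKFree k n : ℝ) =
      ∑ d ∈ Finset.Icc 1 X, ((ArithmeticFunction.moebius d * chiFourMod d ^ k : ℤ) : ℝ) *
        ∑ m ∈ Finset.Icc 1 (X / d ^ k), (chiFourMod m : ℝ) := by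
    exact_mod_cast congrArg (Int.cast : ℤ → ℝ) (sum_chiFourModKFree hk0 X)
  rw [hident]
  refine key.trans ?_
  have t1 : (D : ℝ) * (2 * l ^ 4 + 1) ≤ 769 * (z * Real.exp (-(l / 2))) := by
    have h1 : z / w = z * Real.exp (-(l / 2)) * Real.exp (-(l / 2)) := by
      rw [mul_assoc, ← Real.exp_add, hw, div_eq_mul_inv, ← Real.exp_neg]
      congr 2; ring
    -- The constant is 2·384 + 1, from (l/2)⁴/4! = l⁴/384 ≤ exp(l/2).
    have h2 : (2 * l ^ 4 + 1) * Real.exp (-(l / 2)) ≤ 769 := by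
      rw [Real.exp_neg, ← div_eq_mul_inv, div_le_iff₀ (Real.exp_pos _)]
      have h3 := Real.pow_div_factorial_le_exp (l / 2) (by positivity) 4
      have h4 : (1 : ℝ) ≤ Real.exp (l / 2) := Real.one_le_exp (by positivity)
      have h5 : (l / 2) ^ 4 / (Nat.factorial 4 : ℝ) = l ^ 4 / 384 := by
        have : (Nat.factorial 4 : ℝ) = 24 := by norm_num [Nat.factorial]
        rw [this]; ring
      rw [h5] at h3
      linarith
    calc _ ≤ z / w * (2 * l ^ 4 + 1) := by gcongr
      _ = z * Real.exp (-(l / 2)) * ((2 * l ^ 4 + 1) * Real.exp (-(l / 2))) := by rw [h1]; ring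
      _ ≤ z * Real.exp (-(l / 2)) * 769 := by gcongr
      _ = _ := by ring
  have t2 : (Y : ℝ) * (2 * B) ≤ 2 * C * (z * Real.exp (-(l / 2))) := by
    have h1 : w ^ k * Real.exp (-(c * (l ^ 2 / (2 * k)))) ≤ Real.exp (-(l / 2)) := by
      rw [hw, ← Real.exp_nat_mul, ← Real.exp_add]
      apply Real.exp_le_exp.2
      have h2 : (k + 1) * l ≤ c * (l ^ 2 / (2 * k)) := by
        rw [div_le_iff₀ hc] at hl3
        rw [← mul_div_assoc, le_div_iff₀ (by positivity)]
        nlinarith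
      linarith
    calc _ ≤ w ^ k * (2 * B) := by gcongr
      _ = 2 * C * (z * (w ^ k * Real.exp (-(c * (l ^ 2 / (2 * k)))))) := by rw [hB]; ring
      _ ≤ _ := by gcongr
  linarith

theorem theorem1p1 (k : ℕ) (hk : 2 ≤ k) :
    ∃ f : ArithmeticFunction ℤ,
      f.IsMultiplicative ∧
      (∀ n : ℕ, f n = -1 ∨ f n = 0 ∨ f n = 1) ∧
      (∀ n : ℕ, ¬ IsKFree k n → f n = 0) ∧
      (∀ p : ℕ, p.Prime → f p = 1 ∨ f p = -1) ∧
      ∃ c : ℝ, 0 < c ∧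
        (fun x : ℝ => ∑ n ∈ Finset.Icc 1 ⌊x⌋₊, (f n : ℝ)) =O[atTop]
          (fun x : ℝ => x ^ (1 / (k : ℝ)) / Real.exp (c * Real.log x ^ (1 / 4 : ℝ))) := by
  -- The rate is 1/2 because half of the saving e^{-l} absorbs the factor log x = l⁴.
  refine ⟨chiFourModKFree k, isMultiplicative_chiFourModKFree hk, chiFourModKFree_eq k,
    fun n hn => if_neg hn, fun p hp => ?_, 1 / 2, by norm_num, ?_⟩
  · rw [chiFourModKFree_apply, if_pos (isKFree_of_squarefree hk hp.squarefree)]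
    exact chiFourMod_eq_one_or hp.ne_zero
  · obtain ⟨c, C, hc, hC, hH⟩ := exists_abs_sum_moebius_mul_chiFourMod_pow_le (k := k) (by lia)
    refine IsBigO.of_bound (769 + 2 * C) ?_
    have hlim : Tendsto (fun x : ℝ => Real.log x ^ (1 / 4 : ℝ)) atTop atTop :=
      (tendsto_rpow_atTop (by norm_num)).comp Real.tendsto_log_atTop
    filter_upwards [hlim.eventually_ge_atTop 1, hlim.eventually_ge_atTop (6 * k),
      hlim.eventually_ge_atTop (2 * k * (k + 1) / c), eventually_ge_atTop 1] with x h1 h2 h3 hx1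
    have hlog : 0 ≤ Real.log x := Real.log_nonneg hx1
    have hx0 : 0 < x := by linarith
    set l := Real.log x ^ (1 / 4 : ℝ) with hl
    have hl4 : l ^ 4 = Real.log x := by
      rw [hl, ← Real.rpow_natCast, ← Real.rpow_mul hlog]; norm_num
    have hx : x = Real.exp (l ^ 4) := by rw [hl4, Real.exp_log hx0]
    have hz : x ^ (1 / (k : ℝ)) = Real.exp (l ^ 4 / k) := by
      rw [Real.rpow_def_of_pos hx0, hl4]; congr 1; ring
    have key := abs_sum_chiFourModKFree_le hk hc hC hH h1 h2 h3 hx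
    rw [Real.norm_eq_abs, hz, Real.norm_of_nonneg (by positivity), div_eq_mul_inv, ← Real.exp_neg]
    convert key using 5
    ring
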